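/- Let $G$ be a locally compact second countable (Hausdorff) group. For each $n\ge 1$ let $S_n=(S_n(g))_{g\in G}$ be an ergodic measure preserving (Borel) action of $G$ on a standard probability space $(Z_n,\mathfrak Z_n,\nu_n)$, and let $\mu_n$ be a probability measure on $\mathfrak Z_n$ equivalent to $\nu_n$. Put $(Z,\mathfrak Z,\mu):=\bigotimes_{n}(Z_n,\mathfrak Z_n,\mu_n)$ and $S(g):=\bigotimes_n S_n(g)$, and assume that $\mu\circ S(g)\sim\mu$ for every $g\in G$ (so that $S=(S(g))_{g\in G}$ is an infinite direct product of finite types, IDPFT). Let $\bigoplus_n S_n$ denote the action on $(Z,\mu)$ of the direct sum $\bigoplus_n G$ of countably many copies of $G$ (sequences in $G$ with all but finitely many terms trivial), the $n$-th copy acting on the $n$-th coordinate by $S_n$. For a nonsingular action $T=(T_\gamma)_{\gamma\in\Gamma}$ of a group $\Gamma$ on $(Z,\mu)$, the Maharam extension is the measure preserving action $$\widetilde T_\gamma(z,t):=\Big(T_\gamma z,\ t+\log\frac{d\mu\circ T_\gamma}{d\mu}(z)\Big)$$ of $\Gamma$ on $(Z\times\mathbb R,\ \mu\otimes e^{-t}dt)$.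 Let $\mathcal I(\widetilde T)$ be the $\sigma$-algebra of measurable sets $A\subset Z\times\mathbb R$ that are invariant, modulo null sets, under $\widetilde T_\gamma$ for every $\gamma\in\Gamma$. The associated flow of $T$ is the restriction to $\mathcal I(\widetilde T)$, equipped with (a finite measure equivalent to) $\mu\otimes e^{-t}dt$, of the $\mathbb R$-action $s\mapsto\big((z,t)\mapsto(z,t-s)\big)$. Let $(g_k)_{k=1}^\infty$ be a dispersed sequence in $G$, i.e. for each compact $K\subset G$ there is $N$ such that $g_lg_m^{-1}\notin K$ whenever $l>m>N$, and suppose that for some $\vartheta\in(1,2)$ $$\sum_{k=1}^\infty\Big(\frac{d\mu\circ S(g_k)^{-1}}{d\mu}(z)\Big)^{\vartheta}=+\infty\quad\text{for }\mu\text{-a.e. }z\in Z.$$ Let $H:=\{g_lg_m^{-1} : l>m\}$ and suppose that every $(Z_n,\nu_n,S_n)$ is mixing along $H$, i.e. $\nu_n(S_n(g)A\cap B)\to\nu_n(A)\nu_n(B)$ as $g\to\infty$ within $H$, for all $A,B\in\mathfrak Z_n$. Then $$\mathcal I(\widetilde S)=\mathcal I\Big(\widetilde{\textstyle\bigoplus_n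 S_n}\Big),$$ and hence the associated flow of $S$ coincides with the associated flow of $\bigoplus_n S_n$. -/

import Mathlib

open MeasureTheory Filter Topology Set

open scoped ENNReal

namespace NonsingularDynamics

noncomputable section

/-! ### Nonsingular actions, Radon-Nikodym cocycle, Maharam extension -/

/-- The action of `Γ` on `(Z, μ)` is nonsingular: `μ ∘ T_g ∼ μ` for each `g`. Since `T_g` is
invertible with inverse `T_{g⁻¹}`, the measure `μ ∘ T_g : A ↦ μ (T_g A)` is the image of `μ`
under `T_{g⁻¹}`. -/
def IsNonsingularAction (Γ : Type*) {Z : Type*} [Group Γ] [MulAction Γ Z] [MeasurableSpace Z]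
    (μ : Measure Z) : Prop :=
  ∀ g : Γ, (μ.map fun z => g⁻¹ • z) ≪ μ ∧ μ ≪ (μ.map fun z => g⁻¹ • z)

/-- The Radon-Nikodym cocycle `(g, z) ↦ (d(μ ∘ T_g) / dμ)(z)`. -/
def rnCocycle {Γ Z : Type*} [Group Γ] [MulAction Γ Z] [MeasurableSpace Z]
    (μ : Measure Z) (g : Γ) (z : Z) : ℝ≥0∞ :=
  (μ.map fun w => g⁻¹ • w).rnDeriv μ z

/-- The measure `e^{-t} dt` on the real line. -/
def expMeasure : Measure ℝ :=
  volume.withDensity fun t => ENNReal.ofReal (Real.exp (-t))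

instance : SFinite expMeasure := by
  unfold expMeasure; infer_instance

/-- The measure of the Maharam extension, `μ ⊗ e^{-t} dt` on `Z × ℝ`. -/
def maharamMeasure {Z : Type*} [MeasurableSpace Z] (μ : Measure Z) : Measure (Z × ℝ) :=
  μ.prod expMeasure

instance {Z : Type*} [MeasurableSpace Z] (μ : Measure Z) [SFinite μ] :
    SFinite (maharamMeasure μ) := by
  unfold maharamMeasure; infer_instance

/-- The Maharam extension `(z, t) ↦ (T_g z, t + log (d(μ ∘ T_g) / dμ)(z))`. As the
Radon-Nikodym derivative, it is determined up to a null set. -/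
def maharamExtension {Γ Z : Type*} [Group Γ] [MulAction Γ Z] [MeasurableSpace Z]
    (μ : Measure Z) (g : Γ) (p : Z × ℝ) : Z × ℝ :=
  (g • p.1, p.2 + Real.log (rnCocycle μ g p.1).toReal)

/-- The σ-algebra of (measurable) subsets of `Z × ℝ` that are invariant, modulo null sets, under
every transformation of the Maharam extension of the action of `Γ` on `(Z, μ)`. -/
@[reducible]
def maharamInvariants (Γ : Type*) {Z : Type*} [Group Γ] [MulAction Γ Z] [MeasurableSpace Z]
    (μ : Measure Z) : MeasurableSpace (Z × ℝ) where
  MeasurableSet' A := MeasurableSet A ∧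
    ∀ g : Γ, (maharamExtension μ g) ⁻¹' A =ᵐ[maharamMeasure μ] A
  measurableSet_empty := ⟨MeasurableSet.empty, fun _ => by simp⟩
  measurableSet_compl A hA := ⟨hA.1.compl, fun g => (hA.2 g).compl⟩
  measurableSet_iUnion f hf := ⟨MeasurableSet.iUnion fun i => (hf i).1, fun g => by
    rw [preimage_iUnion]
    exact Filter.EventuallyEq.countable_iUnion fun i => (hf i).2 g⟩

theorem maharamInvariants_le (Γ : Type*) {Z : Type*} [Group Γ] [MulAction Γ Z]
    [mZ : MeasurableSpace Z] (μ : Measure Z) :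
    maharamInvariants Γ μ ≤ (inferInstance : MeasurableSpace (Z × ℝ)) :=
  fun _ hA => hA.1

/-! ### The associated flow -/

/-- The flow `s ↦ ((z, t) ↦ (z, t - s))` on `Z × ℝ`. -/
def fiberTranslation {Z : Type*} (s : ℝ) (p : Z × ℝ) : Z × ℝ := (p.1, p.2 - s)

theorem quasiMeasurePreserving_fiberTranslation {Z : Type*} [MeasurableSpace Z] (μ : Measure Z)
    [SFinite μ] (s : ℝ) :
    Measure.QuasiMeasurePreserving (fiberTranslation (Z := Z) s) (maharamMeasure μ)
      (maharamMeasure μ) := by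
  have hac : expMeasure ≪ (volume : Measure ℝ) := withDensity_absolutelyContinuous _ _
  have hac' : (volume : Measure ℝ) ≪ expMeasure := by
    refine withDensity_absolutelyContinuous' (by fun_prop) ?_
    exact Eventually.of_forall fun t => by simp [Real.exp_pos]
  have h : Measure.QuasiMeasurePreserving (fun t : ℝ => t - s) expMeasure expMeasure :=
    ((measurePreserving_sub_right volume s).quasiMeasurePreserving.mono_left hac).mono_right hac'
  have h2 := MeasureTheory.QuasiMeasurePreserving.prodMap (Measure.QuasiMeasurePreserving.id μ) h
  exact h2

/-- A nonsingular `ℝ`-action on the set `X` equipped with a σ-algebra and a finite measure. -/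
structure NonsingularFlow (X : Type*) where
  /-- the σ-algebra -/
  sigmaAlgebra : MeasurableSpace X
  /-- the measure, of which only the measure class matters -/
  measure : @Measure X sigmaAlgebra
  /-- the measure is finite -/
  isFiniteMeasure : IsFiniteMeasure measure
  /-- the transformations -/
  flow : ℝ → X → X
  /-- the flow starts at the identity -/
  flow_zero : ∀ x, flow 0 x = x
  /-- the flow is additive -/
  flow_add : ∀ s t x, flow (s + t) x = flow s (flow t x)
  /-- every transformation is measurable and nonsingular; by the group law, so is its inverse -/
  nonsingular : ∀ s, Measure.QuasiMeasurePreserving (flow s) measure measure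

/-- The associated flow: the restriction of the flow `(z, t) ↦ (z, t - s)` to the σ-algebra of
subsets invariant under the Maharam extension, equipped with (the restriction to that σ-algebra
of) a finite measure equivalent to the measure of the Maharam extension. -/
def associatedFlow (Γ : Type*) {Z : Type*} [Group Γ] [MulAction Γ Z] [MeasurableSpace Z]
    (μ : Measure Z) [SFinite μ] : NonsingularFlow (Z × ℝ) where
  sigmaAlgebra := maharamInvariants Γ μ
  measure := (maharamMeasure μ).toFinite.trim (maharamInvariants_le Γ μ)
  isFiniteMeasure := inferInstance
  flow := fiberTranslation
  flow_zero x := by simp [fiberTranslation]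
  flow_add s t x := by simp only [fiberTranslation]; congr 1; ring
  nonsingular s := by
    have hq := quasiMeasurePreserving_fiberTranslation μ s
    have hm : @Measurable _ _ (maharamInvariants Γ μ) (maharamInvariants Γ μ)
        (fiberTranslation (Z := Z) s) := by
      rintro A ⟨hA, hinv⟩
      refine ⟨hq.measurable hA, fun g => ?_⟩
      have hcomm : maharamExtension μ g ⁻¹' (fiberTranslation s ⁻¹' A)
          = fiberTranslation s ⁻¹' (maharamExtension μ g ⁻¹' A) := by
        ext p
        simp only [mem_preimage, maharamExtension, fiberTranslation]
        rw [add_sub_right_comm]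
      rw [hcomm]
      exact hq.preimage_ae_eq (hinv g)
    refine @Measure.QuasiMeasurePreserving.mk _ _ (maharamInvariants Γ μ) (maharamInvariants Γ μ)
      _ _ _ hm ?_
    refine @Measure.AbsolutelyContinuous.mk _ (maharamInvariants Γ μ) _ _ fun A hA h0 => ?_
    rw [@Measure.map_apply _ _ (maharamInvariants Γ μ) (maharamInvariants Γ μ) _ _ hm _ hA,
      trim_measurableSet_eq _ (hm hA)]
    rw [trim_measurableSet_eq _ hA] at h0
    exact toFinite_absolutelyContinuous _
      (hq.preimage_null (absolutelyContinuous_toFinite _ h0))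

/-! ### Dispersed sequences and mixing along a set -/

/-- For each compact `K` there is `N` with `g_l g_m⁻¹ ∉ K` whenever `l > m > N`. -/
def IsDispersed {G : Type*} [Group G] [TopologicalSpace G] (g : ℕ → G) : Prop :=
  ∀ K : Set G, IsCompact K → ∃ N : ℕ, ∀ l m : ℕ, N < m → m < l → g l * (g m)⁻¹ ∉ K

/-- The set `{g_l g_m⁻¹ : l > m}`. -/
def differenceSet {G : Type*} [Group G] (g : ℕ → G) : Set G :=
  {h | ∃ l m : ℕ, m < l ∧ h = g l * (g m)⁻¹}

/-- Mixing along `H`: `ν (S_g A ∩ B) → ν A * ν B` as `g → ∞` within `H`, that is, along the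
trace on `H` of the filter of complements of compact sets. -/
def IsMixingAlong {G Z : Type*} [Group G] [TopologicalSpace G] [MulAction G Z]
    [MeasurableSpace Z] (H : Set G) (ν : Measure Z) : Prop :=
  ∀ A B : Set Z, MeasurableSet A → MeasurableSet B →
    Tendsto (fun g : G => ν (((fun z => g • z) '' A) ∩ B)) (cocompact G ⊓ 𝓟 H) (𝓝 (ν A * ν B))

/-! ### Infinite direct products of finite types and direct sums of actions -/

/-- The system `(∏ Z n, ⨂ μ n)` with the diagonal action `g • (z n) = (g • z n)` is an infinite
direct product of finite types, with invariant probability measures `ν n`. -/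
structure IsIDPFT (G : Type*) {Z : ℕ → Type*} [Group G] [∀ n, MulAction G (Z n)]
    [∀ n, MeasurableSpace (Z n)] (ν μ : ∀ n, Measure (Z n))
    [∀ n, IsProbabilityMeasure (ν n)] [∀ n, IsProbabilityMeasure (μ n)] : Prop where
  /-- the `n`-th action preserves `ν n` and is ergodic -/
  ergodic : ∀ n, ErgodicSMul G (Z n) (ν n)
  /-- `μ n` and `ν n` have the same null sets -/
  equivalent : ∀ n, μ n ≪ ν n ∧ ν n ≪ μ n
  /-- the diagonal action is nonsingular for the product measure -/
  nonsingular : IsNonsingularAction G (Measure.infinitePi μ)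

/-- The direct sum of countably many copies of `G`: the sequences in `G` with all but finitely
many terms equal to `1`. It acts on `∏ Z n` by `(γ • z) n = γ n • z n`; this is the direct sum of
the actions of `G` on the factors. -/
def directSum (G : Type*) [Group G] : Subgroup (ℕ → G) where
  carrier := {γ | {n | γ n ≠ 1}.Finite}
  one_mem' := by simp
  mul_mem' {a b} ha hb := (ha.union hb).subset fun n hn => by
    by_contra hc
    simp only [mem_union, mem_ofPred_eq, not_or, not_not] at hc
    exact hn (by simp [hc.1, hc.2])
  inv_mem' {a} ha := by simpa using ha

end

end NonsingularDynamics

open NonsingularDynamics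

namespace NonsingularDynamics

set_option linter.unusedSectionVars false

/-! ### The measure of the Maharam extension -/

/-! Both inclusions are proved set by set. All transformations in play (diagonal elements,
single-coordinate elements, finite truncations) are elements of the full product `ι → G`. That group
need not act nonsingularly, so `NonsingularAt` and `InvariantAt` are tracked element by element.

From the diagonal to the direct sum. The divergent series forces recurrence of the Maharam extension
along the quotients `g l * (g m)⁻¹` (`exists_recurrence`). Otherwise the preimages of some set `B`
of positive measure under the Maharam maps of `g k`, for large `k`, would be pairwise disjoint.
Integrating the finite-mass weight `min (1, exp (ϑ t))` over them would then make the series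
converge on `B`. Next, coordinate `n` is split off. Subtracting the log-density of `μ n` with
respect to `ν n` from the real coordinate turns the Maharam extension into the product of the
Maharam extension of the remaining coordinates with the `ν n`-preserving action
(`maharamSplit_maharamExtension`). The first factor inherits recurrence along the quotients and the
second is mixing along them, so an invariant set has null or conull sections over the first factor
(`ae_section_trivial`). It is therefore invariant under `G` acting on coordinate `n` alone
(`invariantAt_mulSingle`), and finite products of such elements exhaust the direct sum.

From the direct sum to the diagonal. The truncations of a constant sequence lie in the direct sum.
Their Radon-Nikodym derivatives are the conditional expectations of the diagonal derivative on
finitely many coordinates, hence converge almost everywhere by martingale convergence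
(`tendsto_rnCocycle_truncatedConst`). Fatou's lemma on cylinders times half-lines carries invariance
to the limit (`invariantAt_of_tendsto`). -/

theorem measurable_exp_neg_ofReal : Measurable fun t : ℝ => ENNReal.ofReal (Real.exp (-t)) := by
  fun_prop

theorem lintegral_expMeasure {u : ℝ → ℝ≥0∞} (hu : Measurable u) :
    ∫⁻ t, u t ∂expMeasure = ∫⁻ t, ENNReal.ofReal (Real.exp (-t)) * u t := by
  unfold expMeasure
  rw [lintegral_withDensity_eq_lintegral_mul _ measurable_exp_neg_ofReal hu]
  rfl

theorem lintegral_expMeasure_add {u : ℝ → ℝ≥0∞} (hu : Measurable u) (c : ℝ) :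
    ∫⁻ t, u (t + c) ∂expMeasure = ENNReal.ofReal (Real.exp c) * ∫⁻ t, u t ∂expMeasure := by
  rw [lintegral_expMeasure hu, lintegral_expMeasure (by fun_prop),
    ← lintegral_const_mul _ (by fun_prop),
    ← lintegral_add_right_eq_self
      (fun t => ENNReal.ofReal (Real.exp c) * (ENNReal.ofReal (Real.exp (-t)) * u t)) c]
  refine lintegral_congr fun t => ?_
  rw [← mul_assoc, ← ENNReal.ofReal_mul (Real.exp_pos _).le, ← Real.exp_add]
  congr 3
  ring_nf

theorem expMeasure_map_add (c : ℝ) :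
    expMeasure.map (fun t => t + c) = ENNReal.ofReal (Real.exp c) • expMeasure := by
  ext s hs
  have hm : Measurable fun t : ℝ => t + c := by fun_prop
  have h := lintegral_expMeasure_add (u := s.indicator 1) (measurable_one.indicator hs) c
  rw [lintegral_indicator_one hs] at h
  rw [Measure.smul_apply, smul_eq_mul, ← h, Measure.map_apply hm hs,
    ← lintegral_indicator_one (hm hs)]
  rfl

/-- A fibrewise translation by `ℓ` changes the base measure by the density `exp ℓ`. -/
theorem map_skew_prod_expMeasure {Q : Type*} [MeasurableSpace Q] (m : Measure Q) [SFinite m]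
    {l : Q → ℝ} (hl : Measurable l) :
    (m.prod expMeasure).map (fun p => (p.1, p.2 + l p.1))
      = (m.withDensity fun q => ENNReal.ofReal (Real.exp (l q))).prod expMeasure := by
  have hm : Measurable fun p : Q × ℝ => (p.1, p.2 + l p.1) := by fun_prop
  ext s hs
  rw [Measure.map_apply hm hs, Measure.prod_apply (hm hs), Measure.prod_apply hs,
    lintegral_withDensity_eq_lintegral_mul _ (by fun_prop) (measurable_measure_prodMk_left hs)]
  refine lintegral_congr fun q => ?_
  have h := congrArg (fun ρ => ρ (Prod.mk q ⁻¹' s)) (expMeasure_map_add (l q))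
  simp only [Measure.smul_apply, smul_eq_mul] at h
  rw [Measure.map_apply (by fun_prop) (measurable_prodMk_left hs)] at h
  rw [Pi.mul_apply, ← h]
  rfl

/-! ### Single nonsingular transformations of an action -/

/-- The transformation `T_g` of the action is nonsingular for `μ`. -/
def NonsingularAt {Γ Z : Type*} [Group Γ] [MulAction Γ Z] [MeasurableSpace Z]
    (μ : Measure Z) (g : Γ) : Prop :=
  (μ.map fun z => g⁻¹ • z) ≪ μ ∧ μ ≪ (μ.map fun z => g⁻¹ • z)

section Cocycle

variable {Γ Z : Type*} [Group Γ] [MulAction Γ Z] [MeasurableSpace Z] [MeasurableConstSMul Γ Z]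
  {μ : Measure Z} [IsProbabilityMeasure μ] {g h : Γ}

@[fun_prop]
theorem measurable_rnCocycle (μ : Measure Z) (g : Γ) : Measurable (rnCocycle μ g) :=
  Measure.measurable_rnDeriv _ _

theorem isProbabilityMeasure_map_smul (μ : Measure Z) [IsProbabilityMeasure μ] (g : Γ) :
    IsProbabilityMeasure (μ.map fun z => g • z) :=
  Measure.isProbabilityMeasure_map (measurable_const_smul g).aemeasurable

theorem NonsingularAt.withDensity_rnCocycle (hg : NonsingularAt μ g) :
    μ.withDensity (rnCocycle μ g) = μ.map fun z => g⁻¹ • z := by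
  have := isProbabilityMeasure_map_smul μ g⁻¹
  exact Measure.withDensity_rnDeriv_eq _ _ hg.1

theorem rnCocycle_ae_eq {d : Z → ℝ≥0∞} (hd : AEMeasurable d μ)
    (h : (μ.map fun z => g⁻¹ • z) = μ.withDensity d) : rnCocycle μ g =ᵐ[μ] d := by
  unfold rnCocycle
  rw [h]
  exact Measure.rnDeriv_withDensity₀ μ hd

theorem rnCocycle_ne_top (μ : Measure Z) [IsProbabilityMeasure μ] (g : Γ) :
    ∀ᵐ z ∂μ, rnCocycle μ g z ≠ ∞ := by
  have := isProbabilityMeasure_map_smul μ g⁻¹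
  exact Measure.rnDeriv_ne_top _ _

theorem NonsingularAt.rnCocycle_ne_zero (hg : NonsingularAt μ g) :
    ∀ᵐ z ∂μ, rnCocycle μ g z ≠ 0 := by
  have := isProbabilityMeasure_map_smul μ g⁻¹
  have h2 := Measure.rnDeriv_pos (μ := μ.map fun z => g⁻¹ • z) (ν := μ) hg.1
  filter_upwards [hg.2.ae_le h2] with z hz using hz.ne'

theorem nonsingularAt_of_withDensity {d : Z → ℝ≥0∞} (hd : AEMeasurable d μ)
    (h0 : ∀ᵐ z ∂μ, d z ≠ 0) (h : (μ.map fun z => g⁻¹ • z) = μ.withDensity d) :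
    NonsingularAt μ g := by
  unfold NonsingularAt
  rw [h]
  exact ⟨withDensity_absolutelyContinuous _ _, withDensity_absolutelyContinuous' hd h0⟩

theorem NonsingularAt.quasiMeasurePreserving_inv (hg : NonsingularAt μ g) :
    Measure.QuasiMeasurePreserving (fun z => g⁻¹ • z) μ μ :=
  ⟨measurable_const_smul _, hg.1⟩

theorem NonsingularAt.quasiMeasurePreserving (hg : NonsingularAt μ g) :
    Measure.QuasiMeasurePreserving (fun z => g • z) μ μ := by
  refine ⟨measurable_const_smul _, ?_⟩
  have h := hg.2.map (measurable_const_smul g)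
  rw [Measure.map_map (measurable_const_smul g) (measurable_const_smul _)] at h
  have : (fun z : Z => g • z) ∘ (fun z => g⁻¹ • z) = id := by
    ext z; simp
  rwa [this, Measure.map_id] at h

theorem NonsingularAt.of_quasi
    (h1 : Measure.QuasiMeasurePreserving (fun z => g • z) μ μ)
    (h2 : Measure.QuasiMeasurePreserving (fun z => g⁻¹ • z) μ μ) : NonsingularAt μ g := by
  refine ⟨h2.absolutelyContinuous, ?_⟩
  have h := h1.absolutelyContinuous.map (measurable_const_smul g⁻¹)
  rw [Measure.map_map (measurable_const_smul _) (measurable_const_smul _)] at h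
  have : (fun z : Z => g⁻¹ • z) ∘ (fun z => g • z) = id := by
    ext z; simp
  rwa [this, Measure.map_id] at h

theorem NonsingularAt.inv (hg : NonsingularAt μ g) : NonsingularAt μ g⁻¹ :=
  .of_quasi hg.quasiMeasurePreserving_inv (by simpa using hg.quasiMeasurePreserving)

theorem NonsingularAt.mul (hg : NonsingularAt μ g) (hh : NonsingularAt μ h) :
    NonsingularAt μ (g * h) := by
  refine .of_quasi ?_ ?_
  · simpa [Function.comp_def, mul_smul] using
      hg.quasiMeasurePreserving.comp hh.quasiMeasurePreserving
  · simpa [Function.comp_def, mul_smul] using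
      hh.quasiMeasurePreserving_inv.comp hg.quasiMeasurePreserving_inv

theorem nonsingularAt_one : NonsingularAt μ (1 : Γ) :=
  .of_quasi (by simpa using! Measure.QuasiMeasurePreserving.id μ)
    (by simpa using! Measure.QuasiMeasurePreserving.id μ)

theorem rnCocycle_one : rnCocycle μ (1 : Γ) =ᵐ[μ] 1 :=
  rnCocycle_ae_eq aemeasurable_one (by simp)

theorem map_inv_smul_withDensity (u : Z → ℝ≥0∞) (hu : Measurable u) (g : Γ) (μ : Measure Z) :
    (μ.withDensity u).map (fun z => g⁻¹ • z)
      = (μ.map fun z => g⁻¹ • z).withDensity fun z => u (g • z) := by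
  have hm : Measurable fun z : Z => g⁻¹ • z := measurable_const_smul _
  have hm' : Measurable fun z : Z => g • z := measurable_const_smul _
  ext s hs
  rw [Measure.map_apply hm hs, withDensity_apply _ (hm hs), withDensity_apply _ hs,
    setLIntegral_map (f := fun z => u (g • z)) hs (hu.comp hm') hm]
  simp

/-- The cocycle identity of the Radon-Nikodym derivatives. -/
theorem rnCocycle_mul (hg : NonsingularAt μ g) (hh : NonsingularAt μ h) :
    rnCocycle μ (g * h) =ᵐ[μ] fun z => rnCocycle μ g (h • z) * rnCocycle μ h z := by
  have hm : Measurable fun z : Z => rnCocycle μ g (h • z) :=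
    (measurable_rnCocycle μ g).comp (measurable_const_smul h)
  refine rnCocycle_ae_eq (hm.mul (measurable_rnCocycle μ h)).aemeasurable ?_
  have h1 : (fun z : Z => (g * h)⁻¹ • z) = (fun z => h⁻¹ • z) ∘ fun z => g⁻¹ • z := by
    ext z; simp [mul_smul]
  rw [h1, ← Measure.map_map (measurable_const_smul _) (measurable_const_smul _),
    ← hg.withDensity_rnCocycle, map_inv_smul_withDensity _ (measurable_rnCocycle μ g),
    ← hh.withDensity_rnCocycle, ← withDensity_mul _ (measurable_rnCocycle μ h) hm]
  congr 1
  ext z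
  simp [mul_comm]

/-! ### The Maharam extension of a transformation -/

theorem measurable_log_rnCocycle (μ : Measure Z) (g : Γ) :
    Measurable fun z => Real.log (rnCocycle μ g z).toReal :=
  Real.measurable_log.comp (measurable_rnCocycle μ g).ennreal_toReal

theorem measurable_maharamExtension (μ : Measure Z) (g : Γ) :
    Measurable (maharamExtension μ g) := by
  have h2 : Measurable fun z : Z => g • z := measurable_const_smul g
  unfold maharamExtension
  exact (h2.comp measurable_fst).prodMk
    (measurable_snd.add ((measurable_log_rnCocycle μ g).comp measurable_fst))

theorem quasiMeasurePreserving_fst_maharamMeasure (μ : Measure Z) :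
    Measure.QuasiMeasurePreserving Prod.fst (maharamMeasure μ) μ :=
  Measure.quasiMeasurePreserving_fst

theorem ae_maharamMeasure_of_ae {p : Z → Prop} (h : ∀ᵐ z ∂μ, p z) :
    ∀ᵐ q ∂(maharamMeasure μ), p q.1 :=
  (quasiMeasurePreserving_fst_maharamMeasure μ).ae h

theorem NonsingularAt.ofReal_exp_log (hg : NonsingularAt μ g) :
    (fun z => ENNReal.ofReal (Real.exp (Real.log (rnCocycle μ g z).toReal)))
      =ᵐ[μ] rnCocycle μ g := by
  filter_upwards [hg.rnCocycle_ne_zero, rnCocycle_ne_top μ g] with z h0 h1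
  rw [Real.exp_log (ENNReal.toReal_pos h0 h1), ENNReal.ofReal_toReal h1]

/-- The Maharam extension is measure preserving. -/
theorem NonsingularAt.measurePreserving (hg : NonsingularAt μ g) :
    MeasurePreserving (maharamExtension μ g) (maharamMeasure μ) (maharamMeasure μ) := by
  refine ⟨measurable_maharamExtension μ g, ?_⟩
  have := isProbabilityMeasure_map_smul μ g⁻¹
  have hl := measurable_log_rnCocycle μ g
  have h1 : maharamExtension μ g = (Prod.map (fun z : Z => g • z) id) ∘
      fun p : Z × ℝ => (p.1, p.2 + Real.log (rnCocycle μ g p.1).toReal) := rfl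
  have hm : Measurable fun z : Z => g • z := measurable_const_smul g
  have hs : Measurable fun p : Z × ℝ => (p.1, p.2 + Real.log (rnCocycle μ g p.1).toReal) :=
    measurable_fst.prodMk (measurable_snd.add (hl.comp measurable_fst))
  rw [h1, ← Measure.map_map (hm.prodMap measurable_id) hs]
  unfold maharamMeasure
  rw [map_skew_prod_expMeasure μ hl, withDensity_congr_ae hg.ofReal_exp_log,
    hg.withDensity_rnCocycle, ← Measure.map_prod_map _ _ hm measurable_id, Measure.map_id,
    Measure.map_map hm (measurable_const_smul _)]
  have : (fun z : Z => g • z) ∘ (fun z => g⁻¹ • z) = id := by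
    ext z; simp
  rw [this, Measure.map_id]

theorem maharamExtension_mul (hg : NonsingularAt μ g) (hh : NonsingularAt μ h) :
    maharamExtension μ (g * h)
      =ᵐ[maharamMeasure μ] maharamExtension μ g ∘ maharamExtension μ h := by
  filter_upwards [ae_maharamMeasure_of_ae (rnCocycle_mul hg hh),
    ae_maharamMeasure_of_ae hh.rnCocycle_ne_zero,
    ae_maharamMeasure_of_ae (rnCocycle_ne_top μ h),
    ae_maharamMeasure_of_ae (hh.quasiMeasurePreserving.ae hg.rnCocycle_ne_zero),
    ae_maharamMeasure_of_ae (hh.quasiMeasurePreserving.ae (rnCocycle_ne_top μ g))]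
    with p h1 h2 h3 h4 h5
  simp only [maharamExtension, Function.comp_apply, mul_smul, h1, ENNReal.toReal_mul]
  rw [Real.log_mul (ENNReal.toReal_pos h4 h5).ne' (ENNReal.toReal_pos h2 h3).ne']
  congr 1
  ring

theorem maharamExtension_one :
    maharamExtension μ (1 : Γ) =ᵐ[maharamMeasure μ] id := by
  filter_upwards [ae_maharamMeasure_of_ae (rnCocycle_one (Γ := Γ) (μ := μ))] with p h1
  simp [maharamExtension, h1]

theorem NonsingularAt.maharamExtension_inv_comp (hg : NonsingularAt μ g) :
    maharamExtension μ g⁻¹ ∘ maharamExtension μ g =ᵐ[maharamMeasure μ] id := by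
  refine (maharamExtension_mul hg.inv hg).symm.trans ?_
  rw [inv_mul_cancel]
  exact maharamExtension_one

/-- `A` is invariant modulo null sets under the nonsingular transformation `T_g`. -/
def InvariantAt (μ : Measure Z) (A : Set (Z × ℝ)) (g : Γ) : Prop :=
  NonsingularAt μ g ∧ maharamExtension μ g ⁻¹' A =ᵐ[maharamMeasure μ] A

theorem ae_eq_preimage_of_ae_eq {α β : Type*} [MeasurableSpace α] {m : Measure α}
    {f f' : α → β} (h : f =ᵐ[m] f') (A : Set β) : f ⁻¹' A =ᵐ[m] f' ⁻¹' A := by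
  filter_upwards [h] with x hx
  change (f x ∈ A) = (f' x ∈ A)
  rw [hx]

theorem InvariantAt.mul {A : Set (Z × ℝ)} (hg : InvariantAt μ A g) (hh : InvariantAt μ A h) :
    InvariantAt μ A (g * h) := by
  refine ⟨hg.1.mul hh.1, (ae_eq_preimage_of_ae_eq (maharamExtension_mul hg.1 hh.1) A).trans ?_⟩
  rw [preimage_comp]
  exact (hh.1.measurePreserving.quasiMeasurePreserving.preimage_ae_eq hg.2).trans hh.2

theorem invariantAt_one {A : Set (Z × ℝ)} : InvariantAt μ A (1 : Γ) :=
  ⟨nonsingularAt_one, ae_eq_preimage_of_ae_eq maharamExtension_one A⟩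

theorem InvariantAt.compl {A : Set (Z × ℝ)} (hg : InvariantAt μ A g) : InvariantAt μ Aᶜ g :=
  ⟨hg.1, hg.2.compl⟩

end Cocycle

/-! ### Recurrence of the Maharam extension along a sequence -/

/-- If the truncated series converged, its terms would tend to zero, so the truncation at 1 would
eventually be inactive and a tail of the original series would converge. Finiteness of each `a k`
ensures that discarding a finite head keeps the sum infinite. -/
theorem tsum_min_one_mul_eq_top {a : ℕ → ℝ≥0∞} (ha : ∀ k, a k ≠ ∞) (hsum : ∑' k, a k = ∞)
    {c : ℝ≥0∞} (hc : c ≠ 0) (N : ℕ) : ∑' k, min 1 (c * a (k + N)) = ∞ := by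
  by_contra hne
  have h0 := ENNReal.tendsto_cofinite_zero_of_tsum_ne_top hne
  rw [Nat.cofinite_eq_atTop] at h0
  obtain ⟨M, hM⟩ := eventually_atTop.1 (h0.eventually (gt_mem_nhds (zero_lt_one (α := ℝ≥0∞))))
  have htail : ∑' k, min 1 (c * a (k + M + N)) ≠ ∞ := by
    refine ne_top_of_le_ne_top hne ?_
    exact ENNReal.tsum_comp_le_tsum_of_injective (add_left_injective M)
      (fun k => min 1 (c * a (k + N)))
  have heq : ∀ k, min 1 (c * a (k + M + N)) = c * a (k + M + N) := fun k => by
    refine min_eq_right ?_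
    by_contra hlt
    have := hM (k + M) (by omega)
    rw [min_eq_left (le_of_not_ge hlt)] at this
    exact lt_irrefl _ this
  simp_rw [heq] at htail
  rw [ENNReal.tsum_mul_left] at htail
  have h2 : ∑' k, a (k + (M + N)) = ∞ := by
    by_contra h3
    have hs : Summable fun n => a (n + (M + N)) := ENNReal.summable
    have h4 := hs.sum_add_tsum_nat_add'
    rw [hsum] at h4
    exact ENNReal.add_ne_top.2 ⟨ENNReal.sum_ne_top.2 fun k _ => ha k, h3⟩ h4
  simp_rw [add_assoc] at htail
  rw [h2, ENNReal.mul_top hc] at htail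
  exact htail rfl

/-- The weight `min (1, exp (ϑ t))`, which is integrable for `exp (-t) dt` if `ϑ > 1`. -/
noncomputable def truncatedExp (ϑ t : ℝ) : ℝ≥0∞ := min 1 (ENNReal.ofReal (Real.exp (ϑ * t)))

theorem measurable_truncatedExp (ϑ : ℝ) : Measurable (truncatedExp ϑ) := by
  unfold truncatedExp; fun_prop

/-- On the negative half-line the integrand is at most `exp ((ϑ - 1) t)`, integrable because `ϑ >
1`; on the positive half-line it is at most `exp (-t)`. -/
theorem lintegral_truncatedExp_ne_top {ϑ : ℝ} (hϑ : 1 < ϑ) :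
    ∫⁻ t, truncatedExp ϑ t ∂expMeasure ≠ ∞ := by
  rw [lintegral_expMeasure (measurable_truncatedExp ϑ), ← setLIntegral_univ,
    ← Iic_union_Ioi (a := (0 : ℝ))]
  refine ne_top_of_le_ne_top ?_ (lintegral_union_le _ _ _)
  refine ENNReal.add_ne_top.2 ⟨?_, ?_⟩
  · have h := integrableOn_exp_mul_Iic (a := ϑ - 1) (by linarith) 0
    refine ne_top_of_le_ne_top h.lintegral_lt_top.ne (lintegral_mono fun t => ?_)
    refine (mul_le_mul_right (min_le_right _ _) _).trans ?_
    rw [← ENNReal.ofReal_mul (Real.exp_pos _).le, ← Real.exp_add]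
    exact (congrArg (fun x => ENNReal.ofReal (Real.exp x)) (by ring)).le
  · have h := integrableOn_exp_mul_Ioi (a := -1) (by linarith) 0
    refine ne_top_of_le_ne_top h.lintegral_lt_top.ne (lintegral_mono fun t => ?_)
    refine (mul_le_mul_right (min_le_left _ _) _).trans ?_
    rw [mul_one]
    exact (congrArg (fun x => ENNReal.ofReal (Real.exp x)) (by ring)).le

section Recurrence

variable {Γ Z : Type*} [Group Γ] [MulAction Γ Z] [MeasurableSpace Z] [MeasurableConstSMul Γ Z]
  {μ : Measure Z} [IsProbabilityMeasure μ]

/-- The shift by the logarithm of the cocycle becomes multiplication by its `ϑ`-th power, which is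
how the terms of the series enter. -/
theorem NonsingularAt.truncatedExp_maharamExtension {g : Γ} (hg : NonsingularAt μ g) (ϑ : ℝ)
    (hϑ : 0 ≤ ϑ) :
    ∀ᵐ q ∂(maharamMeasure μ), truncatedExp ϑ (maharamExtension μ g q).2
      = min 1 (ENNReal.ofReal (Real.exp (ϑ * q.2)) * rnCocycle μ g q.1 ^ ϑ) := by
  filter_upwards [ae_maharamMeasure_of_ae hg.rnCocycle_ne_zero,
    ae_maharamMeasure_of_ae (rnCocycle_ne_top μ g)] with q h0 h1
  have hp := ENNReal.toReal_pos h0 h1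
  unfold truncatedExp maharamExtension
  rw [mul_add, Real.exp_add, ENNReal.ofReal_mul (Real.exp_pos _).le, mul_comm ϑ (Real.log _),
    ← Real.rpow_def_of_pos hp, ← ENNReal.ofReal_rpow_of_nonneg hp.le hϑ, ENNReal.ofReal_toReal h1]

theorem NonsingularAt.lintegral_preimage_truncatedExp {g : Γ} (hg : NonsingularAt μ g) (ϑ : ℝ)
    {B : Set (Z × ℝ)} (hB : MeasurableSet B) :
    ∫⁻ q in maharamExtension μ g ⁻¹' B, truncatedExp ϑ q.2 ∂(maharamMeasure μ)
      = ∫⁻ q in B, truncatedExp ϑ (maharamExtension μ g⁻¹ q).2 ∂(maharamMeasure μ) := by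
  have hm : Measurable fun q => truncatedExp ϑ (maharamExtension μ g⁻¹ q).2 :=
    (measurable_truncatedExp ϑ).comp (measurable_snd.comp (measurable_maharamExtension μ g⁻¹))
  rw [← hg.measurePreserving.setLIntegral_comp_preimage hB hm]
  refine lintegral_congr_ae (ae_restrict_of_ae ?_)
  filter_upwards [hg.maharamExtension_inv_comp] with q hq
  simp only [Function.comp_apply, id] at hq
  rw [hq]

/-- A Borel-Cantelli type argument on an infinite measure space: pairwise disjoint preimages of `B`
carry finite total weight, while moving the weights back to `B` by measure preservation yields a
truncated form of the divergent series. -/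
theorem exists_recurrence (hns : ∀ γ : Γ, NonsingularAt μ γ) (g : ℕ → Γ) {ϑ : ℝ} (hϑ : 1 < ϑ)
    (hsum : ∀ᵐ z ∂μ, ∑' k, (rnCocycle μ (g k)⁻¹ z) ^ ϑ = ∞)
    {B : Set (Z × ℝ)} (hB : MeasurableSet B) (hpos : maharamMeasure μ B ≠ 0) (N : ℕ) :
    ∃ l m, N < m ∧ m < l ∧
      maharamMeasure μ (B ∩ maharamExtension μ (g l * (g m)⁻¹) ⁻¹' B) ≠ 0 := by
  by_contra! hcon
  -- The shift by `N + 1` keeps only indices larger than `N`, as required for both `l` and `m`.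
  set D : ℕ → Set (Z × ℝ) := fun k => maharamExtension μ (g (k + (N + 1))) ⁻¹' B with hD
  have hDm : ∀ k, MeasurableSet (D k) := fun k => measurable_maharamExtension μ _ hB
  -- The map of the later element is, almost everywhere, that of the quotient composed with that of
  -- the earlier one. So a common point of the two preimages is sent by the earlier map into the set
  -- assumed null.
  have hlt : ∀ k j, k < j → AEDisjoint (maharamMeasure μ) (D k) (D j) := fun k j hkj => by
    have h0 := hcon (j + (N + 1)) (k + (N + 1)) (by omega) (by omega)
    have h1 := (hns (g (k + (N + 1)))).measurePreserving.quasiMeasurePreserving.preimage_null h0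
    have h2 := maharamExtension_mul (hns (g (j + (N + 1)) * (g (k + (N + 1)))⁻¹))
      (hns (g (k + (N + 1))))
    rw [inv_mul_cancel_right] at h2
    refine measure_mono_null_ae ?_ h1
    filter_upwards [h2] with q hq hqD
    refine ⟨hqD.1, ?_⟩
    have := hqD.2
    simp only [hD, mem_preimage] at this
    rw [hq] at this
    exact this
  have hdisj : Pairwise (Function.onFun (AEDisjoint (maharamMeasure μ)) D) := fun k j hkj => by
    rcases lt_or_gt_of_ne hkj with h | h
    · exact hlt k j h
    · exact (hlt j k h).symm
  have hfin : ∫⁻ q, truncatedExp ϑ q.2 ∂(maharamMeasure μ) ≠ ∞ := by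
    unfold maharamMeasure
    have hm2 : Measurable fun q : Z × ℝ => truncatedExp ϑ q.2 :=
      (measurable_truncatedExp ϑ).comp measurable_snd
    rw [lintegral_prod _ hm2.aemeasurable]
    simpa using lintegral_truncatedExp_ne_top hϑ
  have hm : ∀ k, Measurable fun q =>
      truncatedExp ϑ (maharamExtension μ (g (k + (N + 1)))⁻¹ q).2 := fun k =>
    (measurable_truncatedExp ϑ).comp (measurable_snd.comp (measurable_maharamExtension μ _))
  have hsumfin : ∫⁻ q in B, ∑' k,
      truncatedExp ϑ (maharamExtension μ (g (k + (N + 1)))⁻¹ q).2 ∂(maharamMeasure μ) ≠ ∞ := by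
    rw [lintegral_tsum fun k => (hm k).aemeasurable]
    simp_rw [← (hns _).lintegral_preimage_truncatedExp ϑ hB]
    rw [← lintegral_iUnion₀ (fun k => (hDm k).nullMeasurableSet) hdisj]
    exact ne_top_of_le_ne_top hfin (setLIntegral_le_lintegral _ _)
  have hae := ae_lt_top (Measurable.tsum hm) hsumfin
  rw [ae_restrict_iff' hB] at hae
  have hw := ae_all_iff.2 fun k =>
    (hns (g (k + (N + 1)))⁻¹).truncatedExp_maharamExtension ϑ (by linarith)
  have hft := ae_maharamMeasure_of_ae (ae_all_iff.2 fun k => rnCocycle_ne_top μ (g k)⁻¹)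
  refine hpos (measure_eq_zero_iff_ae_notMem.2 ?_)
  filter_upwards [hae, hw, hft, ae_maharamMeasure_of_ae hsum] with q h1 h2 h3 h4 hqB
  refine (h1 hqB).ne ?_
  simp_rw [h2]
  exact tsum_min_one_mul_eq_top (a := fun k => rnCocycle μ (g k)⁻¹ q.1 ^ ϑ)
    (fun k => ENNReal.rpow_ne_top_of_nonneg (by linarith) (h3 k)) h4
    (by simp [Real.exp_pos]) (N + 1)

end Recurrence

/-! ### Products of a mixing system with a recurrent system -/

/-- If a set `C` and its translate by `h` are both close to sets `S`, `S'` with `S' = h S`, then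
`C` is almost invariant under `h`. -/
theorem measureReal_le_image_inter_add {G X : Type*} [Group G] [MulAction G X]
    [MeasurableSpace X] [MeasurableConstSMul G X] (ν : Measure X) [IsFiniteMeasure ν]
    [SMulInvariantMeasure G X ν] (h : G) {C S S' : Set X} (hC : MeasurableSet C)
    (hS' : MeasurableSet S') (hinv : ∀ᵐ x ∂ν, (h • x ∈ S' ↔ x ∈ S)) :
    ν.real C ≤ ν.real (((fun x => h • x) '' C) ∩ C)
      + (ν.real (symmDiff S' C) + ν.real (symmDiff S C)) := by
  have hmp : MeasurePreserving (fun x : X => h • x) ν ν := measurePreserving_smul h ν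
  have hpre : ∀ E : Set X, MeasurableSet E → ν.real ((fun x => h • x) ⁻¹' E) = ν.real E :=
    fun E hE => hmp.measureReal_preimage hE.nullMeasurableSet
  have himg : ((fun x : X => h • x) '' C) = (fun x => h⁻¹ • x) ⁻¹' C := by
    ext x
    constructor
    · rintro ⟨y, hy, rfl⟩; simpa using hy
    · intro hx; exact ⟨h⁻¹ • x, hx, by simp⟩
  have himgm : MeasurableSet (((fun x : X => h • x) '' C) ∩ C) := by
    rw [himg]; exact (measurable_const_smul h⁻¹ hC).inter hC
  have h0 : ν {x | ¬ (h • x ∈ S' ↔ x ∈ S)} = 0 := hinv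
  have h0r : ν.real {x | ¬ (h • x ∈ S' ↔ x ∈ S)} = 0 := by simp [measureReal_def, h0]
  -- Pulling back by `h` puts the sets around `h • x` and the set around `x` on the same copy of
  -- `X`, where a pointwise inclusion suffices.
  rw [← hpre C hC, ← hpre _ himgm, ← hpre _ (hS'.symmDiff hC)]
  have hsub : (fun x : X => h • x) ⁻¹' C ⊆
      (fun x => h • x) ⁻¹' (((fun x => h • x) '' C) ∩ C) ∪
        (((fun x => h • x) ⁻¹' (symmDiff S' C) ∪ symmDiff S C) ∪
          {x | ¬ (h • x ∈ S' ↔ x ∈ S)}) := by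
    intro x hx
    simp only [mem_preimage] at hx
    by_cases hxC : x ∈ C
    · exact Or.inl ⟨mem_image_of_mem _ hxC, hx⟩
    · right
      by_cases h1 : h • x ∈ S'
      · by_cases h2 : x ∈ S
        · exact Or.inl (Or.inr (Or.inl ⟨h2, hxC⟩))
        · exact Or.inr (by simp [h1, h2])
      · exact Or.inl (Or.inl (Or.inr ⟨hx, h1⟩))
  refine (measureReal_mono hsub).trans ((measureReal_union_le _ _).trans ?_)
  gcongr
  refine (measureReal_union_le _ _).trans ?_
  rw [h0r, add_zero]
  exact measureReal_union_le _ _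

/-- A set which is invariant under the product of a mixing probability preserving system with a
recurrent system has trivial sections along the mixing system. -/
theorem ae_section_trivial {G X W : Type*} [Group G] [TopologicalSpace G] [MulAction G X]
    [MeasurableSpace X] [MeasurableSpace.CountablyGenerated X] [MeasurableConstSMul G X]
    (ν : Measure X) [IsProbabilityMeasure ν] [SMulInvariantMeasure G X ν]
    [MeasurableSpace W] (κ : Measure W) {H : Set G} (hmix : IsMixingAlong H ν)
    (R : G → W → W) {A : Set (W × X)} (hA : MeasurableSet A)
    (hinv : ∀ h : G, ∀ᵐ w ∂κ, ∀ᵐ x ∂ν, ((R h w, h • x) ∈ A ↔ (w, x) ∈ A))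
    (hrec : ∀ B : Set W, MeasurableSet B → κ B ≠ 0 →
      ∃ᶠ h in cocompact G ⊓ 𝓟 H, κ (B ∩ R h ⁻¹' B) ≠ 0) :
    ∀ᵐ w ∂κ, ν (Prod.mk w ⁻¹' A) = 0 ∨ ν (Prod.mk w ⁻¹' A) = 1 := by
  set s : W → ℝ := fun w => ν.real (Prod.mk w ⁻¹' A) with hs
  have hsm : Measurable s := (measurable_measure_prodMk_left hA).ennreal_toReal
  have hSm : ∀ w, MeasurableSet (Prod.mk w ⁻¹' A) := fun w => measurable_prodMk_left hA
  suffices hmain : ∀ k : ℕ, κ {w | 1 / ((k : ℝ) + 1) < s w * (1 - s w)} = 0 by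
    have h1 : ∀ᵐ w ∂κ, ∀ k : ℕ, ¬ (1 / ((k : ℝ) + 1) < s w * (1 - s w)) :=
      ae_all_iff.2 fun k => measure_eq_zero_iff_ae_notMem.1 (hmain k)
    filter_upwards [h1] with w hw
    have h2 : s w * (1 - s w) ≤ 0 := by
      by_contra! hpos
      obtain ⟨k, hk⟩ := exists_nat_one_div_lt hpos
      exact hw k hk
    have h3 : 0 ≤ s w := measureReal_nonneg
    have h4 : s w ≤ 1 := measureReal_le_one
    have h5 : s w * (1 - s w) = 0 := le_antisymm h2 (mul_nonneg h3 (by linarith))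
    rcases mul_eq_zero.1 h5 with h6 | h6
    · exact Or.inl ((measureReal_eq_zero_iff).1 h6)
    · right
      have h7 : ν.real (Prod.mk w ⁻¹' A) = 1 := by linarith
      rw [measureReal_def] at h7
      exact (ENNReal.toReal_eq_one_iff _).1 h7
  intro k
  by_contra hpos
  set δ : ℝ := 1 / ((k : ℝ) + 1) with hδ
  have hδ0 : 0 < δ := by positivity
  -- The final estimate gives `δ < 4 ε`: two errors from the symmetric differences, one from mixing,
  -- one from comparing `s w` with `ν.real C`. The factor 10 leaves room.
  set ε : ℝ := δ / 10 with hε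
  have hε0 : 0 < ε := by positivity
  have := isSeparable_of_sigmaFinite ν
  -- Countability lets a single `C` approximate the sections over a set of positive measure, so
  -- mixing need only be used for the pair `C`, `C`.
  obtain ⟨𝒞, h𝒞c, h𝒞⟩ := exists_countable_measureDense ν
  have hcover : {w | δ < s w * (1 - s w)} ⊆
      ⋃ C ∈ 𝒞, {w | δ < s w * (1 - s w) ∧ ν (symmDiff (Prod.mk w ⁻¹' A) C) < ENNReal.ofReal ε} := by
    intro w hw
    obtain ⟨C, hC, hC2⟩ := h𝒞.approx _ (hSm w) (measure_ne_top _ _) ε hε0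
    exact mem_biUnion hC ⟨hw, hC2⟩
  obtain ⟨C, hC, hCpos⟩ : ∃ C ∈ 𝒞, κ {w | δ < s w * (1 - s w) ∧
      ν (symmDiff (Prod.mk w ⁻¹' A) C) < ENNReal.ofReal ε} ≠ 0 := by
    by_contra! h
    exact hpos (measure_mono_null hcover ((measure_biUnion_null_iff h𝒞c).2 h))
  have hCm := h𝒞.measurable C hC
  set B := {w | δ < s w * (1 - s w) ∧ ν (symmDiff (Prod.mk w ⁻¹' A) C) < ENNReal.ofReal ε}
  have hBm : MeasurableSet B := by
    have h1 : MeasurableSet {w | δ < s w * (1 - s w)} :=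
      measurableSet_lt measurable_const (hsm.mul (measurable_const.sub hsm))
    have h2 : Measurable fun w => ν (symmDiff (Prod.mk w ⁻¹' A) C) :=
      measurable_measure_prodMk_left (hA.symmDiff (measurable_snd hCm))
    exact h1.inter (measurableSet_lt h2 measurable_const)
  have hev : ∀ᶠ h in cocompact G ⊓ 𝓟 H,
      ν.real (((fun x => h • x) '' C) ∩ C) < ν.real C * ν.real C + ε := by
    have ht := (ENNReal.tendsto_toReal (by finiteness)).comp (hmix C C hCm hCm)
    rw [ENNReal.toReal_mul] at ht
    exact ht.eventually (gt_mem_nhds (lt_add_of_pos_right _ hε0))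
  -- Recurrence holds frequently and the mixing estimate eventually along the same filter, so one
  -- `h` serves both. The sections at `w` and at `R h w` are then both close to `C`, although one is
  -- the `h`-translate of the other.
  obtain ⟨h, hh1, hh2⟩ := ((hrec B hBm hCpos).and_eventually hev).exists
  obtain ⟨w, ⟨hwB, hwB'⟩, hw⟩ : ∃ w, w ∈ B ∩ R h ⁻¹' B ∧
      ∀ᵐ x ∂ν, ((R h w, h • x) ∈ A ↔ (w, x) ∈ A) := by
    by_contra hcon
    exact hh1 (measure_mono_null (fun w hw hwa => hcon ⟨w, hw, hwa⟩) (hinv h))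
  have hkey := measureReal_le_image_inter_add ν h (C := C) (S := Prod.mk w ⁻¹' A)
    (S' := Prod.mk (R h w) ⁻¹' A) hCm (hSm _) hw
  have htoR : ∀ v ∈ B, ν.real (symmDiff (Prod.mk v ⁻¹' A) C) < ε := fun v hv => by
    have := (ENNReal.toReal_lt_toReal (measure_ne_top _ _) ENNReal.ofReal_ne_top).2 hv.2
    rwa [ENNReal.toReal_ofReal hε0.le] at this
  have e1 := htoR w hwB
  have e2 := htoR _ hwB'
  have e3 := abs_le.1 (abs_measureReal_sub_le_measureReal_symmDiff (μ := ν)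
    (hSm w).nullMeasurableSet hCm.nullMeasurableSet)
  have e4 : δ < s w * (1 - s w) := hwB.1
  have e5 : 0 ≤ s w := measureReal_nonneg
  have e6 : s w ≤ 1 := measureReal_le_one
  have e7 : 0 ≤ ν.real C := measureReal_nonneg
  have e8 : ν.real C ≤ 1 := measureReal_le_one
  have e9 : ν.real (Prod.mk w ⁻¹' A) = s w := rfl
  rw [e9] at e3
  have e10 : s w * (1 - s w) - ν.real C * (1 - ν.real C)
      = (s w - ν.real C) * (1 - s w - ν.real C) := by ring
  have e11 : (s w - ν.real C) * (1 - s w - ν.real C) ≤ ε := by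
    refine (le_abs_self _).trans ?_
    rw [abs_mul]
    have a1 : |s w - ν.real C| ≤ ε := abs_le.2 ⟨by linarith, by linarith⟩
    have a2 : |1 - s w - ν.real C| ≤ 1 := abs_le.2 ⟨by linarith, by linarith⟩
    calc _ ≤ ε * 1 := mul_le_mul a1 a2 (abs_nonneg _) hε0.le
      _ = ε := mul_one _
  have e12 : ν.real C * (1 - ν.real C) = ν.real C - ν.real C * ν.real C := by ring
  linarith

/-! ### Splitting off one coordinate of an infinite product -/

theorem map_withDensity_comp {α β : Type*} [MeasurableSpace α] [MeasurableSpace β] {r : α → β}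
    (hr : Measurable r) {u : β → ℝ≥0∞} (hu : Measurable u) (m : Measure α) :
    (m.withDensity fun x => u (r x)).map r = (m.map r).withDensity u := by
  ext s hs
  rw [Measure.map_apply hr hs, withDensity_apply _ (hr hs), withDensity_apply _ hs,
    setLIntegral_map hs hu hr]

section Split

variable {ι : Type*} [DecidableEq ι] {Z : ι → Type*}

/-- The restriction of a point of the product to the coordinates different from `n`, together with
the coordinate `n`. -/
def splitCoord (n : ι) (z : ∀ i, Z i) : (∀ i : {i // i ≠ n}, Z i) × Z n := (fun i => z i, z n)

/-- The inverse of `splitCoord`. -/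
def glueCoord (n : ι) (p : (∀ i : {i // i ≠ n}, Z i) × Z n) (i : ι) : Z i :=
  if h : i = n then h ▸ p.2 else p.1 ⟨i, h⟩

theorem glueCoord_self (n : ι) (p : (∀ i : {i // i ≠ n}, Z i) × Z n) :
    glueCoord n p n = p.2 := by simp [glueCoord]

theorem glueCoord_of_ne {n i : ι} (h : i ≠ n) (p : (∀ i : {i // i ≠ n}, Z i) × Z n) :
    glueCoord n p i = p.1 ⟨i, h⟩ := by simp [glueCoord, h]

theorem glueCoord_splitCoord (n : ι) (z : ∀ i, Z i) : glueCoord n (splitCoord n z) = z := by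
  ext i
  by_cases h : i = n
  · subst h; exact glueCoord_self _ _
  · exact glueCoord_of_ne h _

theorem splitCoord_glueCoord (n : ι) (p : (∀ i : {i // i ≠ n}, Z i) × Z n) :
    splitCoord n (glueCoord n p) = p := by
  refine Prod.ext ?_ (glueCoord_self n p)
  ext i
  exact glueCoord_of_ne i.2 p

variable [∀ i, MeasurableSpace (Z i)]

theorem measurable_splitCoord (n : ι) : Measurable (splitCoord (Z := Z) n) := by
  unfold splitCoord; fun_prop

theorem measurable_glueCoord (n : ι) : Measurable (glueCoord (Z := Z) n) := by
  refine measurable_pi_iff.2 fun i => ?_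
  by_cases h : i = n
  · subst h
    simp_rw [glueCoord_self]
    exact measurable_snd
  · simp_rw [glueCoord_of_ne h]
    exact (measurable_pi_apply _).comp measurable_fst

variable (μ : ∀ i, Measure (Z i)) [∀ i, IsProbabilityMeasure (μ i)]

theorem map_glueCoord (n : ι) :
    ((Measure.infinitePi fun i : {i // i ≠ n} => μ i).prod (μ n)).map (glueCoord n)
      = Measure.infinitePi μ := by
  refine Measure.eq_infinitePi _ fun s t ht => ?_
  rw [Measure.map_apply (measurable_glueCoord n)
    (MeasurableSet.pi s.countable_toSet fun i _ => ht i)]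
  have hpre : glueCoord n ⁻¹' (Set.pi s t)
      = (Set.pi (s.subtype (fun i => i ≠ n) : Set {i // i ≠ n}) fun i => t i) ×ˢ
        (if n ∈ s then t n else univ) := by
    ext p
    simp only [mem_preimage, Set.mem_pi, mem_prod]
    constructor
    · refine fun h => ⟨fun i hi => ?_, ?_⟩
      · have := h i (by simpa using hi)
        rwa [glueCoord_of_ne i.2] at this
      · split_ifs with hn
        · have := h n hn
          rwa [glueCoord_self] at this
        · trivial
    · rintro ⟨h1, h2⟩ i hi
      by_cases hin : i = n
      · subst hin
        rw [glueCoord_self]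
        rwa [if_pos (by simpa using hi)] at h2
      · rw [glueCoord_of_ne hin]
        exact h1 ⟨i, hin⟩ (by simpa using hi)
  rw [hpre, Measure.prod_prod,
    Measure.infinitePi_pi (fun i : {i // i ≠ n} => μ i) (t := fun i => t i) fun i _ => ht i,
    Finset.prod_subtype_eq_prod_filter (fun i => μ i (t i)), Finset.filter_ne']
  split_ifs with hn
  · rw [mul_comm, Finset.mul_prod_erase s (fun i => μ i (t i)) hn]
  · rw [Finset.erase_eq_of_notMem hn, measure_univ, mul_one]

theorem measurePreserving_splitCoord (n : ι) :
    MeasurePreserving (splitCoord n) (Measure.infinitePi μ)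
      ((Measure.infinitePi fun i : {i // i ≠ n} => μ i).prod (μ n)) := by
  refine ⟨measurable_splitCoord n, ?_⟩
  rw [← map_glueCoord μ n, Measure.map_map (measurable_splitCoord n) (measurable_glueCoord n)]
  have : splitCoord (Z := Z) n ∘ glueCoord n = id := funext (splitCoord_glueCoord n)
  rw [this, Measure.map_id]

end Split

/-! ### Densities with respect to an invariant measure, in logarithmic form -/

section Density

variable {G X : Type*} [Group G] [MulAction G X] [MeasurableSpace X] [MeasurableConstSMul G X]
  {ν m : Measure X} [IsProbabilityMeasure ν] [IsProbabilityMeasure m] [SMulInvariantMeasure G X ν]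

/-- The logarithm of the density `dm / dν`. -/
noncomputable def logDensity (ν m : Measure X) (x : X) : ℝ := Real.log (m.rnDeriv ν x).toReal

@[fun_prop]
theorem measurable_logDensity (ν m : Measure X) : Measurable (logDensity ν m) :=
  Real.measurable_log.comp (Measure.measurable_rnDeriv m ν).ennreal_toReal

theorem withDensity_exp_neg_logDensity (h1 : m ≪ ν) (h2 : ν ≪ m) :
    m.withDensity (fun x => ENNReal.ofReal (Real.exp (-logDensity ν m x))) = ν := by
  have hf0 : ∀ᵐ x ∂ν, m.rnDeriv ν x ≠ 0 := by
    filter_upwards [h2.ae_le (Measure.rnDeriv_pos h1)] with x hx using hx.ne'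
  have hft := Measure.rnDeriv_ne_top m ν
  conv_rhs => rw [← withDensity_inv_same (Measure.measurable_rnDeriv m ν) hf0 hft,
    Measure.withDensity_rnDeriv_eq _ _ h1]
  refine withDensity_congr_ae (h1.ae_le ?_)
  filter_upwards [hf0, hft] with x h0 ht
  have hp := ENNReal.toReal_pos h0 ht
  rw [logDensity, Real.exp_neg, Real.exp_log hp, ENNReal.ofReal_inv_of_pos hp,
    ENNReal.ofReal_toReal ht]

theorem withDensity_exp_logDensity (h1 : m ≪ ν) (h2 : ν ≪ m) :
    ν.withDensity (fun x => ENNReal.ofReal (Real.exp (logDensity ν m x))) = m := by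
  have hf0 : ∀ᵐ x ∂ν, m.rnDeriv ν x ≠ 0 := by
    filter_upwards [h2.ae_le (Measure.rnDeriv_pos h1)] with x hx using hx.ne'
  have hft := Measure.rnDeriv_ne_top m ν
  conv_rhs => rw [← Measure.withDensity_rnDeriv_eq _ _ h1]
  refine withDensity_congr_ae ?_
  filter_upwards [hf0, hft] with x h0 ht
  rw [logDensity, Real.exp_log (ENNReal.toReal_pos h0 ht), ENNReal.ofReal_toReal ht]

/-- If `ν` is invariant, then the Radon-Nikodym cocycle of `m ∼ ν` is the coboundary of the
density of `m`. -/
theorem map_inv_smul_eq_withDensity_logDensity (h1 : m ≪ ν) (h2 : ν ≪ m) (γ : G) :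
    (m.map fun x => γ⁻¹ • x)
      = m.withDensity fun x =>
        ENNReal.ofReal (Real.exp (logDensity ν m (γ • x) - logDensity ν m x)) := by
  have hu : Measurable fun x => ENNReal.ofReal (Real.exp (logDensity ν m x)) := by fun_prop
  have hs : Measurable fun x : X => γ • x := measurable_const_smul γ
  have hu' : Measurable fun x => ENNReal.ofReal (Real.exp (logDensity ν m (γ • x))) :=
    hu.comp hs
  have e : (m.map fun x => γ⁻¹ • x)
      = ν.withDensity fun x => ENNReal.ofReal (Real.exp (logDensity ν m (γ • x))) := by
    conv_lhs => rw [← withDensity_exp_logDensity h1 h2]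
    rw [map_inv_smul_withDensity _ hu, (measurePreserving_smul γ⁻¹ ν).map_eq]
  have e2 := withDensity_mul m (f := fun x => ENNReal.ofReal (Real.exp (-logDensity ν m x)))
    (by fun_prop) hu'
  rw [withDensity_exp_neg_logDensity h1 h2] at e2
  rw [e, ← e2]
  congr 1
  ext x
  rw [Pi.mul_apply, ← ENNReal.ofReal_mul (Real.exp_pos _).le, ← Real.exp_add]
  congr 2
  ring

end Density

/-! ### Radon-Nikodym cocycles of product actions -/

section ProductAction

variable {ι : Type*} [DecidableEq ι] {Z : ι → Type*} {G : Type*} [Group G]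
  [∀ i, MulAction G (Z i)] [∀ i, MeasurableSpace (Z i)] [∀ i, MeasurableConstSMul G (Z i)]

instance measurableConstSMul_pi : MeasurableConstSMul (ι → G) (∀ i, Z i) :=
  ⟨fun a => measurable_pi_iff.2 fun i => (measurable_pi_apply i).const_smul (a i)⟩

/-- The restriction of a sequence of group elements to the indices different from `n`. -/
def restCoord (n : ι) (a : ι → G) : {i // i ≠ n} → G := fun i => a i

theorem restCoord_mulSingle (n : ι) (γ : G) :
    restCoord n (Pi.mulSingle n γ : ι → G) = 1 := by
  ext i
  simp [restCoord, i.2]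

instance measurableConstSMul_rest (n : ι) :
    MeasurableConstSMul ({i // i ≠ n} → G) (∀ i : {i // i ≠ n}, Z i) :=
  ⟨fun a => measurable_pi_iff.2 fun i => (measurable_pi_apply i).const_smul (a i)⟩

theorem glueCoord_smul (n : ι) (a : ι → G) (p : (∀ i : {i // i ≠ n}, Z i) × Z n) :
    glueCoord n (restCoord n a • p.1, a n • p.2) = a • glueCoord n p := by
  ext i
  by_cases h : i = n
  · subst h
    rw [glueCoord_self, Pi.smul_apply', glueCoord_self]
  · rw [glueCoord_of_ne h, Pi.smul_apply', glueCoord_of_ne h]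
    rfl

/-- The remaining coordinates form a measure-preserving image of the full product, equivariant for
the actions, so null sets can be tested after pulling them back. -/
theorem NonsingularAt.restCoord {μ : ∀ i, Measure (Z i)} [∀ i, IsProbabilityMeasure (μ i)]
    {a : ι → G} (ha : NonsingularAt (Measure.infinitePi μ) a) (n : ι) :
    NonsingularAt (Measure.infinitePi fun i : {i // i ≠ n} => μ i) (restCoord n a) := by
  have hr : MeasurePreserving (fun (z : ∀ i, Z i) (i : {i // i ≠ n}) => z i)
      (Measure.infinitePi μ) (Measure.infinitePi fun i : {i // i ≠ n} => μ i) :=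
    (measurePreserving_fst (μ := Measure.infinitePi fun i : {i // i ≠ n} => μ i)
      (ν := μ n)).comp (measurePreserving_splitCoord μ n)
  have key : ∀ b : ι → G, Measure.QuasiMeasurePreserving (fun z => b • z)
      (Measure.infinitePi μ) (Measure.infinitePi μ) →
      Measure.QuasiMeasurePreserving (fun y => NonsingularDynamics.restCoord n b • y)
        (Measure.infinitePi fun i : {i // i ≠ n} => μ i)
        (Measure.infinitePi fun i : {i // i ≠ n} => μ i) := by
    intro b hb
    have hm : Measurable fun y : (∀ i : {i // i ≠ n}, Z i) =>
      NonsingularDynamics.restCoord n b • y := measurable_const_smul _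
    refine ⟨hm, Measure.AbsolutelyContinuous.mk fun s hs h0 => ?_⟩
    rw [Measure.map_apply hm hs, ← hr.measure_preimage (hm hs).nullMeasurableSet]
    rw [← hr.measure_preimage hs.nullMeasurableSet] at h0
    exact hb.preimage_null h0
  exact .of_quasi (key a ha.quasiMeasurePreserving) (key a⁻¹ ha.quasiMeasurePreserving_inv)

variable (ν μ : ∀ i, Measure (Z i)) [∀ i, IsProbabilityMeasure (ν i)]
  [∀ i, IsProbabilityMeasure (μ i)] [∀ i, SMulInvariantMeasure G (Z i) (ν i)]

/-- Only one factor is separated, so no infinite product formula for the cocycle is needed: the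
remaining coordinates contribute their own derivative and coordinate `n` contributes a coboundary.
-/
theorem map_inv_smul_infinitePi {n : ι} (h1 : μ n ≪ ν n) (h2 : ν n ≪ μ n) {a : ι → G}
    (ha : NonsingularAt (Measure.infinitePi fun i : {i // i ≠ n} => μ i) (restCoord n a)) :
    ((Measure.infinitePi μ).map fun z => a⁻¹ • z)
      = (Measure.infinitePi μ).withDensity fun z =>
        rnCocycle (Measure.infinitePi fun i : {i // i ≠ n} => μ i) (restCoord n a)
          (splitCoord n z).1 *
        ENNReal.ofReal (Real.exp (logDensity (ν n) (μ n) (a n • z n)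
          - logDensity (ν n) (μ n) (z n))) := by
  have hs : Measurable fun x : Z n => a n • x := measurable_const_smul _
  have hs' : Measurable fun x : Z n => (a n)⁻¹ • x := measurable_const_smul _
  have hy : Measurable fun y : (∀ i : {i // i ≠ n}, Z i) => (restCoord n a)⁻¹ • y :=
    measurable_const_smul _
  have hd : Measurable fun x : Z n => ENNReal.ofReal (Real.exp
      (logDensity (ν n) (μ n) (a n • x) - logDensity (ν n) (μ n) x)) := by fun_prop
  have hψ := measurable_rnCocycle
    (Measure.infinitePi fun i : {i // i ≠ n} => μ i) (restCoord n a)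
  have hglue : (fun z : ∀ i, Z i => a⁻¹ • z) ∘ glueCoord n
      = glueCoord n ∘ Prod.map (fun y => (restCoord n a)⁻¹ • y) (fun x => (a n)⁻¹ • x) := by
    ext1 p
    exact (glueCoord_smul n a⁻¹ p).symm
  have := isProbabilityMeasure_map_smul (Γ := {i // i ≠ n} → G)
    (Measure.infinitePi fun i : {i // i ≠ n} => μ i) (restCoord n a)⁻¹
  have := isProbabilityMeasure_map_smul (Γ := G) (μ n) (a n)⁻¹
  have hu : Measurable fun z : ∀ i, Z i =>
      rnCocycle (Measure.infinitePi fun i : {i // i ≠ n} => μ i) (restCoord n a)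
          (splitCoord n z).1 *
        ENNReal.ofReal (Real.exp (logDensity (ν n) (μ n) (a n • z n)
          - logDensity (ν n) (μ n) (z n))) :=
    (hψ.comp (measurable_fst.comp (measurable_splitCoord n))).mul
      (hd.comp (measurable_pi_apply n))
  conv_lhs => rw [← map_glueCoord μ n]
  conv_rhs => rw [← map_glueCoord μ n]
  rw [Measure.map_map (measurable_const_smul _) (measurable_glueCoord n), hglue,
    ← Measure.map_map (measurable_glueCoord n) (hy.prodMap hs'),
    ← Measure.map_prod_map _ _ hy hs', ← ha.withDensity_rnCocycle,
    map_inv_smul_eq_withDensity_logDensity h1 h2,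
    prod_withDensity hψ hd, ← map_withDensity_comp (measurable_glueCoord n) hu]
  simp only [splitCoord_glueCoord, glueCoord_self]

theorem nonsingularAt_infinitePi {n : ι} (h1 : μ n ≪ ν n) (h2 : ν n ≪ μ n) {a : ι → G}
    (ha : NonsingularAt (Measure.infinitePi fun i : {i // i ≠ n} => μ i) (restCoord n a)) :
    NonsingularAt (Measure.infinitePi μ) a := by
  have hs : Measurable fun x : Z n => a n • x := measurable_const_smul _
  have hψ := measurable_rnCocycle
    (Measure.infinitePi fun i : {i // i ≠ n} => μ i) (restCoord n a)
  have hd : Measurable fun x : Z n => ENNReal.ofReal (Real.exp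
      (logDensity (ν n) (μ n) (a n • x) - logDensity (ν n) (μ n) x)) := by fun_prop
  refine nonsingularAt_of_withDensity ?_ ?_ (map_inv_smul_infinitePi ν μ h1 h2 ha)
  · exact ((hψ.comp (measurable_fst.comp (measurable_splitCoord n))).mul
      (hd.comp (measurable_pi_apply n))).aemeasurable
  · have hq : Measure.QuasiMeasurePreserving (fun z : ∀ i, Z i => (splitCoord n z).1)
        (Measure.infinitePi μ) (Measure.infinitePi fun i : {i // i ≠ n} => μ i) :=
      Measure.quasiMeasurePreserving_fst.comp
        (measurePreserving_splitCoord μ n).quasiMeasurePreserving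
    filter_upwards [hq.ae ha.rnCocycle_ne_zero] with z hz
    exact mul_ne_zero hz (by simp [Real.exp_pos])

/-- The Radon-Nikodym cocycle of a product action, with one factor split off. -/
theorem rnCocycle_infinitePi {n : ι} (h1 : μ n ≪ ν n) (h2 : ν n ≪ μ n) {a : ι → G}
    (ha : NonsingularAt (Measure.infinitePi fun i : {i // i ≠ n} => μ i) (restCoord n a)) :
    ∀ᵐ z ∂(Measure.infinitePi μ),
      rnCocycle (Measure.infinitePi μ) a z =
        rnCocycle (Measure.infinitePi fun i : {i // i ≠ n} => μ i) (restCoord n a)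
          (splitCoord n z).1 *
        ENNReal.ofReal (Real.exp (logDensity (ν n) (μ n) (a n • z n)
          - logDensity (ν n) (μ n) (z n))) := by
  have hs : Measurable fun x : Z n => a n • x := measurable_const_smul _
  have hψ := measurable_rnCocycle
    (Measure.infinitePi fun i : {i // i ≠ n} => μ i) (restCoord n a)
  have hd : Measurable fun x : Z n => ENNReal.ofReal (Real.exp
      (logDensity (ν n) (μ n) (a n • x) - logDensity (ν n) (μ n) x)) := by fun_prop
  exact rnCocycle_ae_eq ((hψ.comp (measurable_fst.comp (measurable_splitCoord n))).mul
      (hd.comp (measurable_pi_apply n))).aemeasurable (map_inv_smul_infinitePi ν μ h1 h2 ha)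

end ProductAction

/-! ### Splitting the Maharam extension of a product -/

theorem measurePreserving_prod_right_comm {α β γ : Type*} [MeasurableSpace α] [MeasurableSpace β]
    [MeasurableSpace γ] (a : Measure α) (b : Measure β) (c : Measure γ) [SFinite a] [SFinite b]
    [SFinite c] :
    MeasurePreserving (fun p : (α × β) × γ => ((p.1.1, p.2), p.1.2)) ((a.prod b).prod c)
      ((a.prod c).prod b) := by
  have h1 := measurePreserving_prodAssoc a b c
  have h2 : MeasurePreserving (Prod.map (id : α → α) (Prod.swap : β × γ → γ × β))
      (a.prod (b.prod c)) (a.prod (c.prod b)) :=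
    (MeasurePreserving.id a).prod Measure.measurePreserving_swap
  have h3 := (measurePreserving_prodAssoc a c b).symm
  exact h3.comp (h2.comp h1)

section Split

variable {ι : Type*} [DecidableEq ι] {Z : ι → Type*}

/-- Splits `Z × ℝ` into the Maharam space of the coordinates different from `n` and the
coordinate `n`, the real coordinate being corrected by the function `l` of the coordinate `n`. -/
def maharamSplit (n : ι) (l : Z n → ℝ) (q : (∀ i, Z i) × ℝ) :
    ((∀ i : {i // i ≠ n}, Z i) × ℝ) × Z n :=
  (((splitCoord n q.1).1, q.2 - l (q.1 n)), q.1 n)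

/-- The inverse of `maharamSplit`. -/
def maharamGlue (n : ι) (l : Z n → ℝ) (p : ((∀ i : {i // i ≠ n}, Z i) × ℝ) × Z n) :
    (∀ i, Z i) × ℝ :=
  (glueCoord n (p.1.1, p.2), p.1.2 + l p.2)

theorem maharamGlue_maharamSplit (n : ι) (l : Z n → ℝ) (q : (∀ i, Z i) × ℝ) :
    maharamGlue n l (maharamSplit n l q) = q :=
  Prod.ext (glueCoord_splitCoord n q.1) (by simp [maharamGlue, maharamSplit])

variable [∀ i, MeasurableSpace (Z i)]

theorem measurable_maharamGlue (n : ι) {l : Z n → ℝ} (hl : Measurable l) :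
    Measurable (maharamGlue n l) :=
  ((measurable_glueCoord n).comp (by fun_prop)).prodMk (by fun_prop)

variable (ν μ : ∀ i, Measure (Z i)) [∀ i, IsProbabilityMeasure (ν i)]
  [∀ i, IsProbabilityMeasure (μ i)]

/-- Translating the real coordinate by minus the log-density multiplies the base measure by the
inverse density under `exp (-t) dt`, which replaces the factor `μ n` by the invariant `ν n`. -/
theorem measurePreserving_maharamSplit {n : ι} (h1 : μ n ≪ ν n) (h2 : ν n ≪ μ n) :
    MeasurePreserving (maharamSplit n (logDensity (ν n) (μ n)))
      (maharamMeasure (Measure.infinitePi μ))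
      ((maharamMeasure (Measure.infinitePi fun i : {i // i ≠ n} => μ i)).prod (ν n)) := by
  have hl : Measurable fun z : ∀ i, Z i => -logDensity (ν n) (μ n) (z n) := by fun_prop
  have hskew : Measurable fun q : (∀ i, Z i) × ℝ =>
      (q.1, q.2 + -logDensity (ν n) (μ n) (q.1 n)) := by fun_prop
  have hu : Measurable fun x : Z n => ENNReal.ofReal (Real.exp (-logDensity (ν n) (μ n) x)) := by
    fun_prop
  have hs := measurable_splitCoord (Z := Z) n
  have e1 : ((Measure.infinitePi μ).withDensity fun z =>
        ENNReal.ofReal (Real.exp (-logDensity (ν n) (μ n) (z n)))).map (splitCoord n)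
      = (Measure.infinitePi fun i : {i // i ≠ n} => μ i).prod (ν n) := by
    have h := map_withDensity_comp (m := Measure.infinitePi μ) hs (hu.comp measurable_snd)
    rw [(measurePreserving_splitCoord μ n).map_eq] at h
    refine h.trans ?_
    have h' := prod_withDensity_right (μ := Measure.infinitePi fun i : {i // i ≠ n} => μ i)
      (ν := μ n) hu
    rw [withDensity_exp_neg_logDensity h1 h2] at h'
    exact h'.symm
  have hmap : MeasurePreserving (Prod.map (splitCoord n) id ∘
      fun q : (∀ i, Z i) × ℝ => (q.1, q.2 + -logDensity (ν n) (μ n) (q.1 n)))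
      (maharamMeasure (Measure.infinitePi μ))
      (((Measure.infinitePi fun i : {i // i ≠ n} => μ i).prod (ν n)).prod expMeasure) := by
    refine ⟨(hs.prodMap measurable_id).comp hskew, ?_⟩
    rw [← Measure.map_map (hs.prodMap measurable_id) hskew]
    unfold maharamMeasure
    -- The density may be unbounded; finiteness is read off from the image, a product of probability
    -- measures.
    have hfin : IsFiniteMeasure ((Measure.infinitePi μ).withDensity fun z =>
        ENNReal.ofReal (Real.exp (-logDensity (ν n) (μ n) (z n)))) := by
      refine ⟨?_⟩
      rw [← preimage_univ (f := splitCoord (Z := Z) n), ← Measure.map_apply hs .univ, e1]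
      exact measure_lt_top _ _
    rw [map_skew_prod_expMeasure _ hl, ← Measure.map_prod_map _ _ hs measurable_id, e1,
      Measure.map_id]
  have h3 := (measurePreserving_prod_right_comm
    (Measure.infinitePi fun i : {i // i ≠ n} => μ i) (ν n) expMeasure).comp hmap
  have e : maharamSplit n (logDensity (ν n) (μ n)) =
      (fun p : ((∀ i : {i // i ≠ n}, Z i) × Z n) × ℝ => ((p.1.1, p.2), p.1.2)) ∘
        (Prod.map (splitCoord n) id ∘
          fun q : (∀ i, Z i) × ℝ => (q.1, q.2 + -logDensity (ν n) (μ n) (q.1 n))) := by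
    ext1 q
    simp [maharamSplit, splitCoord, sub_eq_add_neg]
  rw [e]
  exact h3

variable {G : Type*} [Group G] [∀ i, MulAction G (Z i)] [∀ i, MeasurableConstSMul G (Z i)]
  [∀ i, SMulInvariantMeasure G (Z i) (ν i)]

/-- `maharamSplit` conjugates the Maharam extension of the product to the product of the Maharam
extension of the remaining coordinates with the action on the `n`-th coordinate. -/
theorem maharamSplit_maharamExtension {n : ι} (h1 : μ n ≪ ν n) (h2 : ν n ≪ μ n) {a : ι → G}
    (ha : NonsingularAt (Measure.infinitePi fun i : {i // i ≠ n} => μ i) (restCoord n a)) :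
    ∀ᵐ q ∂(maharamMeasure (Measure.infinitePi μ)),
      maharamSplit n (logDensity (ν n) (μ n)) (maharamExtension (Measure.infinitePi μ) a q)
        = (maharamExtension (Measure.infinitePi fun i : {i // i ≠ n} => μ i) (restCoord n a)
            (maharamSplit n (logDensity (ν n) (μ n)) q).1,
          a n • (maharamSplit n (logDensity (ν n) (μ n)) q).2) := by
  have hq : Measure.QuasiMeasurePreserving (fun z : ∀ i, Z i => (splitCoord n z).1)
      (Measure.infinitePi μ) (Measure.infinitePi fun i : {i // i ≠ n} => μ i) :=
    Measure.quasiMeasurePreserving_fst.comp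
      (measurePreserving_splitCoord μ n).quasiMeasurePreserving
  filter_upwards [ae_maharamMeasure_of_ae (rnCocycle_infinitePi ν μ h1 h2 ha),
    ae_maharamMeasure_of_ae (hq.ae ha.rnCocycle_ne_zero),
    ae_maharamMeasure_of_ae (hq.ae (rnCocycle_ne_top
      (Measure.infinitePi fun i : {i // i ≠ n} => μ i) (restCoord n a)))] with q e1 e2 e3
  simp only [maharamSplit, maharamExtension, e1, ENNReal.toReal_mul,
    ENNReal.toReal_ofReal (Real.exp_pos _).le, Pi.smul_apply']
  rw [Real.log_mul (ENNReal.toReal_pos e2 e3).ne' (Real.exp_pos _).ne', Real.log_exp]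
  refine Prod.ext (Prod.ext rfl ?_) rfl
  simp only
  ring

end Split

/-! ### From diagonal invariance to invariance in a single coordinate -/

section Mixing

variable {ι : Type*} [DecidableEq ι] {Z : ι → Type*} [∀ i, MeasurableSpace (Z i)]
  [∀ i, StandardBorelSpace (Z i)]
  {G : Type*} [Group G] [TopologicalSpace G]
  [∀ i, MulAction G (Z i)] [∀ i, MeasurableConstSMul G (Z i)]
  (ν μ : ∀ i, Measure (Z i)) [∀ i, IsProbabilityMeasure (ν i)]
  [∀ i, IsProbabilityMeasure (μ i)] [∀ i, SMulInvariantMeasure G (Z i) (ν i)]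

/-- If the diagonal Maharam extension is recurrent along `H` and the `n`-th factor is mixing along
`H`, then a set invariant under the diagonal action is invariant under the action of `G` on the
`n`-th coordinate alone. -/
theorem invariantAt_mulSingle {n : ι} (h1 : μ n ≪ ν n) (h2 : ν n ≪ μ n) {H : Set G}
    (hmix : IsMixingAlong H (ν n))
    {A : Set ((∀ i, Z i) × ℝ)} (hA : MeasurableSet A)
    (hinv : ∀ h : G, InvariantAt (Measure.infinitePi μ) A (fun _ : ι => h))
    (hrec : ∀ B : Set ((∀ i, Z i) × ℝ), MeasurableSet B →
      maharamMeasure (Measure.infinitePi μ) B ≠ 0 →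
      ∃ᶠ h in cocompact G ⊓ 𝓟 H, maharamMeasure (Measure.infinitePi μ)
        (B ∩ maharamExtension (Measure.infinitePi μ) (fun _ : ι => h) ⁻¹' B) ≠ 0)
    (γ : G) : InvariantAt (Measure.infinitePi μ) A (Pi.mulSingle n γ : ι → G) := by
  set μY := Measure.infinitePi fun i : {i // i ≠ n} => μ i with hμY
  set l := logDensity (ν n) (μ n) with hl
  have hlm : Measurable l := measurable_logDensity _ _
  have hΘ := measurePreserving_maharamSplit ν μ h1 h2
  set A' : Set (((∀ i : {i // i ≠ n}, Z i) × ℝ) × Z n) := maharamGlue n l ⁻¹' A with hA'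
  have hA'm : MeasurableSet A' := measurable_maharamGlue n hlm hA
  have hmem : ∀ q, q ∈ A ↔ maharamSplit n l q ∈ A' := fun q => by
    rw [hA', mem_preimage, maharamGlue_maharamSplit]
  have hns : ∀ h : G, NonsingularAt μY (restCoord n fun _ : ι => h) := fun h =>
    (hinv h).1.restCoord n
  have hRm : ∀ h : G, Measurable (maharamExtension μY (restCoord n fun _ : ι => h)) := fun h =>
    measurable_maharamExtension _ _
  have hsm : ∀ h : G, Measurable fun x : Z n => h • x := fun h => measurable_const_smul h
  have hinv' : ∀ h : G, ∀ᵐ w ∂(maharamMeasure μY), ∀ᵐ x ∂(ν n),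
      ((maharamExtension μY (restCoord n fun _ : ι => h) w, h • x) ∈ A' ↔ (w, x) ∈ A') := by
    intro h
    refine Measure.ae_ae_of_ae_prod (p := fun p =>
      ((maharamExtension μY (restCoord n fun _ : ι => h) p.1, h • p.2) ∈ A' ↔ p ∈ A')) ?_
    have hbad : MeasurableSet {p | (((maharamExtension μY (restCoord n fun _ : ι => h) p.1,
        h • p.2) : _ × Z n) ∈ A' ↔ p ∈ A')} :=
      MeasurableSet.iff (((hRm h).prodMap (hsm h)) hA'm) hA'm
    rw [← hΘ.map_eq, ae_map_iff hΘ.aemeasurable hbad]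
    filter_upwards [maharamSplit_maharamExtension ν μ h1 h2 (hns h), (hinv h).2.mem_iff]
      with q e1 e2
    have e3 := hmem (maharamExtension (Measure.infinitePi μ) (fun _ : ι => h) q)
    rw [e1] at e3
    exact e3.symm.trans (e2.trans (hmem q))
  -- Recurrence descends to the factor: it is applied to the cylinder over `B` in the full Maharam
  -- space.
  have hrec' : ∀ B : Set ((∀ i : {i // i ≠ n}, Z i) × ℝ), MeasurableSet B →
      maharamMeasure μY B ≠ 0 → ∃ᶠ h in cocompact G ⊓ 𝓟 H,
        maharamMeasure μY (B ∩ maharamExtension μY (restCoord n fun _ : ι => h) ⁻¹' B) ≠ 0 := by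
    intro B hB hB0
    have hpre : ∀ E : Set ((∀ i : {i // i ≠ n}, Z i) × ℝ), MeasurableSet E →
        maharamMeasure (Measure.infinitePi μ) (maharamSplit n l ⁻¹' (Prod.fst ⁻¹' E))
          = maharamMeasure μY E := fun E hE => by
      rw [hΘ.measure_preimage (measurable_fst hE).nullMeasurableSet,
        measurePreserving_fst.measure_preimage hE.nullMeasurableSet]
    refine (hrec (maharamSplit n l ⁻¹' (Prod.fst ⁻¹' B))
      (hΘ.measurable (measurable_fst hB)) (by rwa [hpre B hB])).mono fun h hh => ?_
    rw [← hpre _ (hB.inter (hRm h hB))]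
    intro h0
    refine hh (measure_mono_null_ae ?_ h0)
    filter_upwards [maharamSplit_maharamExtension ν μ h1 h2 (hns h)] with q e1 hq
    have hq2 : (maharamSplit n l (maharamExtension (Measure.infinitePi μ)
      (fun _ : ι => h) q)).1 ∈ B := hq.2
    rw [e1] at hq2
    exact ⟨hq.1, hq2⟩
  have htriv := ae_section_trivial (ν n) (maharamMeasure μY) hmix
    (fun h => maharamExtension μY (restCoord n fun _ : ι => h)) hA'm hinv' hrec'
  have hrest := restCoord_mulSingle n γ
  have hns1 : NonsingularAt μY (restCoord n (Pi.mulSingle n γ : ι → G)) := by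
    rw [hrest]; exact nonsingularAt_one
  refine ⟨nonsingularAt_infinitePi ν μ h1 h2 hns1, ?_⟩
  -- Null and conull sections are both unchanged, up to null sets, by the `ν n`-preserving map `γ`.
  have hmove : ∀ᵐ p ∂((maharamMeasure μY).prod (ν n)), ((p.1, γ • p.2) ∈ A' ↔ p ∈ A') := by
    have hbad : MeasurableSet {p : ((∀ i : {i // i ≠ n}, Z i) × ℝ) × Z n |
        ((p.1, γ • p.2) ∈ A' ↔ p ∈ A')} :=
      MeasurableSet.iff ((measurable_id.prodMap (hsm γ)) hA'm) hA'm
    rw [Measure.ae_prod_iff_ae_ae hbad]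
    filter_upwards [htriv] with w hw
    have hqmp := (measurePreserving_smul γ (ν n)).quasiMeasurePreserving
    rcases hw with hw | hw
    · have e := measure_eq_zero_iff_ae_notMem.1 hw
      filter_upwards [e, hqmp.ae e] with x hx hx'
      exact iff_of_false hx' hx
    · have e : ∀ᵐ x ∂(ν n), x ∈ Prod.mk w ⁻¹' A' :=
        (prob_compl_eq_zero_iff (measurable_prodMk_left hA'm)).2 hw
      filter_upwards [e, hqmp.ae e] with x hx hx'
      exact iff_of_true hx' hx
  have hone : ∀ᵐ w ∂(maharamMeasure μY), maharamExtension μY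
      (restCoord n (Pi.mulSingle n γ : ι → G)) w = w := by
    rw [hrest]; exact maharamExtension_one
  refine Filter.eventuallyEq_set.2 ?_
  filter_upwards [maharamSplit_maharamExtension ν μ h1 h2 hns1, hΘ.quasiMeasurePreserving.ae hmove,
    (Measure.quasiMeasurePreserving_fst.comp hΘ.quasiMeasurePreserving).ae hone] with q e1 e2 e3
  rw [mem_preimage, hmem, e1, hmem q]
  simp only [Function.comp_apply] at e3
  rw [e3, Pi.mulSingle_eq_same]
  exact e2

end Mixing

/-! ### Approximating the diagonal action by the direct sum -/

theorem expMeasure_Ioi_ne_top (a : ℝ) : expMeasure (Ioi a) ≠ ∞ := by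
  unfold expMeasure
  rw [withDensity_apply _ measurableSet_Ioi]
  have h := integrableOn_exp_mul_Ioi (a := -1) (by linarith) a
  simpa using h.lintegral_lt_top.ne

section Limit

variable {Γ Z : Type*} [Group Γ] [MulAction Γ Z] [MeasurableSpace Z] [MeasurableConstSMul Γ Z]
  {μ : Measure Z} [IsProbabilityMeasure μ] {c : ℕ → Γ} {g : Γ} {A : Set (Z × ℝ)}

/-- Fatou's lemma gives this one-sided bound. The half-line is open, so a point sent into `C ×ˢ Ioi
a` by the limit map is eventually sent there by the approximants, and for those the measure is
exactly the right-hand side by invariance. -/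
theorem measure_inter_preimage_le_of_tendsto (hA : MeasurableSet A)
    (hc : ∀ N, InvariantAt μ A (c N)) (hg : NonsingularAt μ g)
    (hlim : ∀ᵐ z ∂μ, Tendsto (fun N => (rnCocycle μ (c N) z).toReal) atTop
      (𝓝 (rnCocycle μ g z).toReal))
    {C : Set Z} (hC : MeasurableSet C) (hCc : ∀ᶠ N in atTop, ∀ z, c N • z ∈ C ↔ g • z ∈ C)
    (a : ℝ) :
    maharamMeasure μ (A ∩ maharamExtension μ g ⁻¹' (C ×ˢ Ioi a))
      ≤ maharamMeasure μ (A ∩ C ×ˢ Ioi a) := by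
  have hD : MeasurableSet (C ×ˢ Ioi a) := hC.prod measurableSet_Ioi
  have hE : ∀ h : Γ, MeasurableSet (A ∩ maharamExtension μ h ⁻¹' (C ×ˢ Ioi a)) := fun h =>
    hA.inter (measurable_maharamExtension μ h hD)
  have hN : ∀ N, maharamMeasure μ (A ∩ maharamExtension μ (c N) ⁻¹' (C ×ˢ Ioi a))
      = maharamMeasure μ (A ∩ C ×ˢ Ioi a) := fun N => by
    rw [← (hc N).1.measurePreserving.measure_preimage (hA.inter hD).nullMeasurableSet,
      preimage_inter]
    exact measure_congr ((hc N).2.symm.inter EventuallyEq.rfl)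
  have hev : ∀ᵐ q ∂(maharamMeasure μ), q ∈ A ∩ maharamExtension μ g ⁻¹' (C ×ˢ Ioi a) →
      ∀ᶠ N in atTop, q ∈ A ∩ maharamExtension μ (c N) ⁻¹' (C ×ˢ Ioi a) := by
    filter_upwards [ae_maharamMeasure_of_ae hlim, ae_maharamMeasure_of_ae hg.rnCocycle_ne_zero,
      ae_maharamMeasure_of_ae (rnCocycle_ne_top μ g)] with q h1 h2 h3 hq
    have ht : Tendsto (fun N => q.2 + Real.log (rnCocycle μ (c N) q.1).toReal) atTop
        (𝓝 (q.2 + Real.log (rnCocycle μ g q.1).toReal)) :=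
      (h1.log (ENNReal.toReal_pos h2 h3).ne').const_add _
    have hqa : a < q.2 + Real.log (rnCocycle μ g q.1).toReal := hq.2.2
    filter_upwards [hCc, ht.eventually (lt_mem_nhds hqa)] with N e1 e2
    exact ⟨hq.1, (e1 q.1).2 hq.2.1, e2⟩
  calc maharamMeasure μ (A ∩ maharamExtension μ g ⁻¹' (C ×ˢ Ioi a))
      = ∫⁻ q, (A ∩ maharamExtension μ g ⁻¹' (C ×ˢ Ioi a)).indicator 1 q ∂(maharamMeasure μ) :=
        (lintegral_indicator_one (hE g)).symm
    _ ≤ ∫⁻ q, liminf (fun N => (A ∩ maharamExtension μ (c N) ⁻¹' (C ×ˢ Ioi a)).indicator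
          (1 : Z × ℝ → ℝ≥0∞) q) atTop ∂(maharamMeasure μ) := by
        refine lintegral_mono_ae ?_
        filter_upwards [hev] with q hq
        by_cases hqA : q ∈ A ∩ maharamExtension μ g ⁻¹' (C ×ˢ Ioi a)
        · rw [indicator_of_mem hqA]
          refine le_liminf_of_le (by isBoundedDefault) ?_
          filter_upwards [hq hqA] with N hNq
          rw [indicator_of_mem hNq]
        · rw [indicator_of_notMem hqA]
          exact zero_le
    _ ≤ liminf (fun N => ∫⁻ q, (A ∩ maharamExtension μ (c N) ⁻¹' (C ×ˢ Ioi a)).indicator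
          (1 : Z × ℝ → ℝ≥0∞) q ∂(maharamMeasure μ)) atTop :=
        lintegral_liminf_le fun N => measurable_one.indicator (hE (c N))
    _ = maharamMeasure μ (A ∩ C ×ˢ Ioi a) := by
        simp_rw [lintegral_indicator_one (hE _), hN]
        exact liminf_const _

/-- Invariance passes to limits of transformations, if the Radon-Nikodym derivatives converge and
the transformations eventually agree on a generating π-system. -/
theorem invariantAt_of_tendsto (hA : MeasurableSet A)
    (hc : ∀ N, InvariantAt μ A (c N)) (hg : NonsingularAt μ g)
    (hlim : ∀ᵐ z ∂μ, Tendsto (fun N => (rnCocycle μ (c N) z).toReal) atTop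
      (𝓝 (rnCocycle μ g z).toReal))
    {𝒞 : Set (Set Z)} (hgen : MeasurableSpace.generateFrom 𝒞 = ‹MeasurableSpace Z›)
    (hpi : IsPiSystem 𝒞) (huniv : univ ∈ 𝒞)
    (hCc : ∀ C ∈ 𝒞, ∀ᶠ N in atTop, ∀ z, c N • z ∈ C ↔ g • z ∈ C) :
    InvariantAt μ A g := by
  have hCm : ∀ C ∈ 𝒞, MeasurableSet C := fun C hC => by
    rw [← hgen]; exact MeasurableSpace.measurableSet_generateFrom hC
  have hT := hg.measurePreserving
  have hDfin : ∀ (C : Set Z) (a : ℝ), maharamMeasure μ (C ×ˢ Ioi a) ≠ ∞ := fun C a => by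
    unfold maharamMeasure
    rw [Measure.prod_prod]
    exact ENNReal.mul_ne_top (measure_ne_top _ _) (expMeasure_Ioi_ne_top a)
  have heq : ∀ E, MeasurableSet E → (∀ N, InvariantAt μ E (c N)) → ∀ C ∈ 𝒞, ∀ a : ℝ,
      maharamMeasure μ (E ∩ maharamExtension μ g ⁻¹' (C ×ˢ Ioi a))
      = maharamMeasure μ (E ∩ C ×ˢ Ioi a) := by
    intro E hE hEc C hC a
    have h1 := measure_inter_preimage_le_of_tendsto hE hEc hg hlim (hCm C hC) (hCc C hC) a
    -- The same bound for the complement, together with equality of the finite total masses, turns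
    -- the inequality into an equality.
    have h2 := measure_inter_preimage_le_of_tendsto hE.compl (fun N => (hEc N).compl) hg hlim
      (hCm C hC) (hCc C hC) a
    have h3 : maharamMeasure μ (maharamExtension μ g ⁻¹' (C ×ˢ Ioi a))
        = maharamMeasure μ (C ×ˢ Ioi a) :=
      hT.measure_preimage ((hCm C hC).prod measurableSet_Ioi).nullMeasurableSet
    have h4 := measure_inter_add_sdiff (μ := maharamMeasure μ) (C ×ˢ Ioi a) hE
    have h5 := measure_inter_add_sdiff (μ := maharamMeasure μ)
      (maharamExtension μ g ⁻¹' (C ×ˢ Ioi a)) hE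
    rw [Set.sdiff_eq, inter_comm _ E, inter_comm _ Eᶜ] at h4 h5
    refine le_antisymm h1 ?_
    by_contra! hlt
    have hne : maharamMeasure μ (Eᶜ ∩ maharamExtension μ g ⁻¹' (C ×ˢ Ioi a)) ≠ ∞ :=
      ne_top_of_le_ne_top (hDfin C a) (h2.trans (measure_mono inter_subset_right))
    have := ENNReal.add_lt_add_of_lt_of_le hne hlt h2
    rw [h4, h5, h3] at this
    exact lt_irrefl _ this
  have key : ∀ E : Set (Z × ℝ), MeasurableSet E →
      (∀ C ∈ 𝒞, ∀ a : ℝ, maharamMeasure μ (E ∩ maharamExtension μ g ⁻¹' (C ×ˢ Ioi a))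
        = maharamMeasure μ (E ∩ C ×ˢ Ioi a)) →
      maharamMeasure μ (E ∩ maharamExtension μ g ⁻¹' Eᶜ) = 0 := by
    intro E hE hEeq
    have hTm := measurable_maharamExtension μ g
    -- Agreement on the π-system shows that the map preserves the restriction of the measure to `E`,
    -- so almost no point of `E` leaves `E`. The half-lines `Ioi (-k)` exhaust the line and have
    -- finite mass for `exp (-t) dt`.
    have hmeas : ((maharamMeasure μ).restrict E).map (maharamExtension μ g)
        = (maharamMeasure μ).restrict E := by
      refine Measure.ext_of_generateFrom_of_iUnion
        (image2 (fun C D => C ×ˢ D) 𝒞 (range Ioi)) (fun k : ℕ => univ ×ˢ Ioi (-(k : ℝ)))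
        ?_ (hpi.prod isPiSystem_Ioi) ?_ (fun k => mem_image2_of_mem huniv (mem_range_self _)) ?_ ?_
      · refine (generateFrom_eq_prod hgen ?_ ⟨fun _ => univ, fun _ => huniv, iUnion_const _⟩
          ⟨fun k : ℕ => Ioi (-(k : ℝ)), fun k => mem_range_self _, ?_⟩).symm
        · rw [← borel_eq_generateFrom_Ioi ℝ]
          exact (BorelSpace.measurable_eq (α := ℝ)).symm
        · refine eq_univ_of_forall fun t => ?_
          obtain ⟨k, hk⟩ := exists_nat_gt (-t)
          exact mem_iUnion.2 ⟨k, by simp only [mem_Ioi]; linarith⟩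
      · refine eq_univ_of_forall fun q => ?_
        obtain ⟨k, hk⟩ := exists_nat_gt (-q.2)
        exact mem_iUnion.2 ⟨k, trivial, by simp only [mem_Ioi]; linarith⟩
      · intro k
        rw [Measure.map_apply hTm (MeasurableSet.univ.prod measurableSet_Ioi)]
        refine ne_top_of_le_ne_top ?_ (Measure.restrict_apply_le _ _)
        rw [hT.measure_preimage (MeasurableSet.univ.prod measurableSet_Ioi).nullMeasurableSet]
        exact hDfin _ _
      · rintro _ ⟨C, hC, _, ⟨a, rfl⟩, rfl⟩
        have hm : MeasurableSet (C ×ˢ Ioi a) := (hCm C hC).prod measurableSet_Ioi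
        rw [Measure.map_apply hTm hm, Measure.restrict_apply (hTm hm), Measure.restrict_apply hm,
          inter_comm, hEeq C hC a, inter_comm]
    have h := congrArg (fun ρ => ρ Eᶜ) hmeas
    rw [Measure.map_apply hTm hE.compl, Measure.restrict_apply (hTm hE.compl),
      Measure.restrict_apply hE.compl, compl_inter_self, measure_empty, inter_comm] at h
    exact h
  refine ⟨hg, ?_⟩
  have k1 := measure_eq_zero_iff_ae_notMem.1 (key A hA (heq A hA hc))
  have k2 := measure_eq_zero_iff_ae_notMem.1 
    (key Aᶜ hA.compl (heq Aᶜ hA.compl fun N => (hc N).compl))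
  refine Filter.eventuallyEq_set.2 ?_
  filter_upwards [k1, k2] with q h1 h2
  simp only [mem_inter_iff, mem_preimage, mem_compl_iff, not_and, not_not] at h1 h2
  exact ⟨fun h => by_contra fun hq => h2 hq h, h1⟩

end Limit

/-! ### Truncations of a constant sequence and martingale convergence -/

section Truncation

variable {Z : ℕ → Type*} [∀ i, MeasurableSpace (Z i)]
  {G : Type*} [Group G] [∀ i, MulAction G (Z i)] [∀ i, MeasurableConstSMul G (Z i)]
  (ν μ : ∀ i, Measure (Z i)) [∀ i, IsProbabilityMeasure (ν i)]
  [∀ i, IsProbabilityMeasure (μ i)] [∀ i, SMulInvariantMeasure G (Z i) (ν i)]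

/-- The sequence with the first `N` terms equal to `g` and the other terms equal to `1`. -/
def truncatedConst (g : G) (N i : ℕ) : G := if i < N then g else 1

theorem truncatedConst_zero (g : G) : truncatedConst g 0 = 1 := by
  ext i; simp [truncatedConst]

theorem truncatedConst_succ (g : G) (N : ℕ) :
    truncatedConst g (N + 1) = Pi.mulSingle N g * truncatedConst g N := by
  ext i
  rcases lt_trichotomy i N with h | h | h
  · simp [truncatedConst, h, h.ne, h.trans (Nat.lt_succ_self N)]
  · subst h; simp [truncatedConst]
  · simp [truncatedConst, h.ne', h.le, not_lt.2 (Nat.succ_le_of_lt h)]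

theorem nonsingularAt_mulSingle {n : ℕ} (h1 : μ n ≪ ν n) (h2 : ν n ≪ μ n) (γ : G) :
    NonsingularAt (Measure.infinitePi μ) (Pi.mulSingle n γ : ℕ → G) := by
  refine nonsingularAt_infinitePi ν μ h1 h2 ?_
  rw [restCoord_mulSingle]
  exact nonsingularAt_one

theorem rnCocycle_mulSingle {n : ℕ} (h1 : μ n ≪ ν n) (h2 : ν n ≪ μ n) (γ : G) :
    ∀ᵐ z ∂(Measure.infinitePi μ),
      rnCocycle (Measure.infinitePi μ) (Pi.mulSingle n γ : ℕ → G) z =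
        ENNReal.ofReal (Real.exp (logDensity (ν n) (μ n) (γ • z n)
          - logDensity (ν n) (μ n) (z n))) := by
  have hns : NonsingularAt (Measure.infinitePi fun i : {i // i ≠ n} => μ i)
      (restCoord n (Pi.mulSingle n γ : ℕ → G)) := by
    rw [restCoord_mulSingle]; exact nonsingularAt_one
  have hq : Measure.QuasiMeasurePreserving (fun z : ∀ i, Z i => (splitCoord n z).1)
      (Measure.infinitePi μ) (Measure.infinitePi fun i : {i // i ≠ n} => μ i) :=
    Measure.quasiMeasurePreserving_fst.comp
      (measurePreserving_splitCoord μ n).quasiMeasurePreserving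
  have hone := hq.ae (rnCocycle_one (Γ := {i // i ≠ n} → G)
    (μ := Measure.infinitePi fun i : {i // i ≠ n} => μ i))
  filter_upwards [rnCocycle_infinitePi ν μ h1 h2 hns, hone] with z e1 e2
  rw [e1, restCoord_mulSingle, e2, Pi.one_apply, one_mul, Pi.mulSingle_eq_same]

theorem rnCocycle_truncatedConst (h1 : ∀ n, μ n ≪ ν n) (h2 : ∀ n, ν n ≪ μ n) (g : G) (N : ℕ) :
    NonsingularAt (Measure.infinitePi μ) (truncatedConst g N) ∧
      rnCocycle (Measure.infinitePi μ) (truncatedConst g N) =ᵐ[Measure.infinitePi μ] fun z =>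
        ∏ n ∈ Finset.range N, ENNReal.ofReal (Real.exp (logDensity (ν n) (μ n) (g • z n)
          - logDensity (ν n) (μ n) (z n))) := by
  induction N with
  | zero =>
    rw [truncatedConst_zero]
    refine ⟨nonsingularAt_one, ?_⟩
    filter_upwards [rnCocycle_one (Γ := ℕ → G) (μ := Measure.infinitePi μ)] with z hz
    simp [hz]
  | succ N ih =>
    have hs := nonsingularAt_mulSingle ν μ (h1 N) (h2 N) g
    rw [truncatedConst_succ]
    refine ⟨hs.mul ih.1, ?_⟩
    filter_upwards [rnCocycle_mul hs ih.1, ih.2,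
      ih.1.quasiMeasurePreserving.ae (rnCocycle_mulSingle ν μ (h1 N) (h2 N) g)] with z e1 e2 e3
    -- The truncation at `N` moves only the coordinates below `N`, so the new factor of the cocycle
    -- is evaluated at the original `z N`.
    have e4 : (truncatedConst g N • z) N = z N := by simp [truncatedConst]
    rw [e1, e2, e3, e4, Finset.prod_range_succ, mul_comm]

/-- The truncation and the diagonal element agree on the first coordinates, hence give equal image
measure to every set depending only on them. As the derivative of the truncation also depends only
on these coordinates, it is the conditional expectation of the diagonal derivative, and Lévy's
upward theorem applies. -/
theorem tendsto_rnCocycle_truncatedConst (h1 : ∀ n, μ n ≪ ν n) (h2 : ∀ n, ν n ≪ μ n) {g : G}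
    (hg : NonsingularAt (Measure.infinitePi μ) (fun _ : ℕ => g)) :
    ∀ᵐ z ∂(Measure.infinitePi μ), Tendsto
      (fun N => (rnCocycle (Measure.infinitePi μ) (truncatedConst g (N + 1)) z).toReal) atTop
      (𝓝 (rnCocycle (Measure.infinitePi μ) (fun _ : ℕ => g) z).toReal) := by
  have := isProbabilityMeasure_map_smul (Measure.infinitePi μ) (fun _ : ℕ => g)⁻¹
  have hint : Integrable (fun z => (rnCocycle (Measure.infinitePi μ) (fun _ : ℕ => g) z).toReal)
      (Measure.infinitePi μ) := Measure.integrable_toReal_rnDeriv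
  -- `Filtration.piLE N` contains the coordinates `0, …, N`, hence truncation at `N + 1`.
  have hcond : ∀ N, (fun z =>
      (rnCocycle (Measure.infinitePi μ) (truncatedConst g (N + 1)) z).toReal)
      =ᵐ[Measure.infinitePi μ] (Measure.infinitePi μ)[fun z =>
        (rnCocycle (Measure.infinitePi μ) (fun _ : ℕ => g) z).toReal | Filtration.piLE N] := by
    intro N
    obtain ⟨hns, hform⟩ := rnCocycle_truncatedConst ν μ h1 h2 g (N + 1)
    have := isProbabilityMeasure_map_smul (Measure.infinitePi μ) (truncatedConst g (N + 1))⁻¹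
    have hint' : Integrable (fun z =>
        (rnCocycle (Measure.infinitePi μ) (truncatedConst g (N + 1)) z).toReal)
        (Measure.infinitePi μ) := Measure.integrable_toReal_rnDeriv
    refine ae_eq_condExp_of_forall_setIntegral_eq (Filtration.piLE.le N) hint
      (fun s _ _ => hint'.integrableOn) (fun s hs _ => ?_) ?_
    · have e1 := Measure.setIntegral_toReal_rnDeriv hns.1 s
      have e2 := Measure.setIntegral_toReal_rnDeriv hg.1 s
      have hsm := Filtration.piLE.le N s hs
      refine e1.trans (Eq.trans ?_ e2.symm)
      rw [measureReal_def, measureReal_def, Measure.map_apply (measurable_const_smul _) hsm,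
        Measure.map_apply (measurable_const_smul _) hsm]
      obtain ⟨t, -, rfl⟩ := hs
      congr 2
      ext z
      simp only [mem_preimage]
      have : Preorder.restrictLe N ((truncatedConst g (N + 1))⁻¹ • z)
          = Preorder.restrictLe N ((fun _ : ℕ => g)⁻¹ • z) := by
        ext i
        have hi : (i : ℕ) < N + 1 := Nat.lt_succ_of_le i.2
        simp [Preorder.restrictLe, truncatedConst, hi]
      rw [this]
    · refine ⟨fun z => (∏ n ∈ Finset.range (N + 1), ENNReal.ofReal (Real.exp
        (logDensity (ν n) (μ n) (g • z n) - logDensity (ν n) (μ n) (z n)))).toReal, ?_, ?_⟩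
      · refine Measurable.stronglyMeasurable (Measurable.ennreal_toReal ?_)
        refine Finset.measurable_fun_prod _ fun n hn => ?_
        have hd : Measurable fun x : Z n => ENNReal.ofReal (Real.exp
            (logDensity (ν n) (μ n) (g • x) - logDensity (ν n) (μ n) x)) := by
          have hs : Measurable fun x : Z n => g • x := measurable_const_smul _
          fun_prop
        have hle : n ≤ N := Nat.lt_succ_iff.1 (Finset.mem_range.1 hn)
        have hev : Measurable[Filtration.piLE N] fun z : ∀ i, Z i => z n :=
          (measurable_pi_apply (⟨n, hle⟩ : Iic N)).comp
            (comap_measurable (Preorder.restrictLe (π := Z) N))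
        exact hd.comp hev
      · filter_upwards [hform] with z hz
        rw [hz]
  have hsup : ⨆ N, (Filtration.piLE (X := Z) N : MeasurableSpace (∀ i, Z i))
      = MeasurableSpace.pi := by
    refine le_antisymm (iSup_le fun N => Filtration.piLE.le N) ?_
    refine iSup_le fun n => ?_
    refine le_trans ?_ (le_iSup _ n)
    have hev : Measurable[Filtration.piLE n] fun z : ∀ i, Z i => z n :=
      (measurable_pi_apply (⟨n, le_refl n⟩ : Iic n)).comp
        (comap_measurable (Preorder.restrictLe (π := Z) n))
    exact hev.comap_le
  have hmart := hint.tendsto_ae_condExp (ℱ := Filtration.piLE) (by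
    rw [hsup]
    exact (measurable_rnCocycle _ _).ennreal_toReal.stronglyMeasurable)
  filter_upwards [hmart, ae_all_iff.2 hcond] with z e1 e2
  simpa only [e2] using e1

/-- A set which is invariant under the actions on the single coordinates is invariant under the
diagonal action. -/
theorem invariantAt_const (h1 : ∀ n, μ n ≪ ν n) (h2 : ∀ n, ν n ≪ μ n) {g : G}
    (hg : NonsingularAt (Measure.infinitePi μ) (fun _ : ℕ => g))
    {A : Set ((∀ i, Z i) × ℝ)} (hA : MeasurableSet A)
    (hinv : ∀ n, InvariantAt (Measure.infinitePi μ) A (Pi.mulSingle n g : ℕ → G)) :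
    InvariantAt (Measure.infinitePi μ) A (fun _ : ℕ => g) := by
  have hc : ∀ N, InvariantAt (Measure.infinitePi μ) A (truncatedConst g N) := by
    intro N
    induction N with
    | zero => rw [truncatedConst_zero]; exact invariantAt_one
    | succ N ih => rw [truncatedConst_succ]; exact (hinv N).mul ih
  refine invariantAt_of_tendsto hA (fun N => hc (N + 1)) hg
    (tendsto_rnCocycle_truncatedConst ν μ h1 h2 hg) generateFrom_measurableCylinders
    isPiSystem_measurableCylinders (univ_mem_measurableCylinders Z) fun C hC => ?_
  obtain ⟨s, S, -, rfl⟩ := (mem_measurableCylinders C).1 hC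
  obtain ⟨M, hM⟩ := s.exists_nat_subset_range
  filter_upwards [eventually_ge_atTop M] with N hN z
  rw [mem_cylinder, mem_cylinder]
  have : s.restrict (truncatedConst g (N + 1) • z) = s.restrict ((fun _ : ℕ => g) • z) := by
    ext i
    have hi : (i : ℕ) < N + 1 := by
      have := Finset.mem_range.1 (hM i.2)
      omega
    simp [Finset.restrict, truncatedConst, hi]
  rw [this]

end Truncation

/-! ### Generating the direct sum by single coordinates -/

section DirectSum

variable {Z : ℕ → Type*} [∀ i, MeasurableSpace (Z i)]
  {G : Type*} [Group G] [∀ i, MulAction G (Z i)] [∀ i, MeasurableConstSMul G (Z i)]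
  {μ : Measure (∀ i, Z i)} [IsProbabilityMeasure μ]

/-- Invariance under the actions on the single coordinates is invariance under the direct sum. -/
theorem invariantAt_of_finite_support {A : Set ((∀ i, Z i) × ℝ)}
    (hinv : ∀ n (γ : G), InvariantAt μ A (Pi.mulSingle n γ : ℕ → G)) (s : Finset ℕ) :
    ∀ a : ℕ → G, (∀ n ∉ s, a n = 1) → InvariantAt μ A a := by
  induction s using Finset.induction_on with
  | empty =>
    intro a ha
    have : a = 1 := funext fun n => ha n (Finset.notMem_empty n)
    rw [this]
    exact invariantAt_one
  | insert n s _ ih =>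
    intro a ha
    have e : a = Pi.mulSingle n (a n) * Function.update a n 1 := by
      ext i
      by_cases h : i = n
      · subst h; simp
      · simp [h]
    rw [e]
    refine (hinv n (a n)).mul (ih _ fun i hi => ?_)
    by_cases h : i = n
    · subst h; simp
    · rw [Function.update_of_ne h]
      exact ha i (by simp [h, hi])

end DirectSum

theorem mulSingle_mem_directSum {G : Type*} [Group G] (n : ℕ) (γ : G) :
    (Pi.mulSingle n γ : ℕ → G) ∈ directSum G := by
  refine (finite_singleton n).subset fun i hi => ?_
  by_contra h
  exact hi (Pi.mulSingle_eq_of_ne (M := fun _ => G) h γ)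

theorem associatedFlow_congr {Γ Γ' Z : Type*} [Group Γ] [Group Γ'] [MulAction Γ Z]
    [MulAction Γ' Z] [MeasurableSpace Z] (μ : Measure Z) [SFinite μ]
    (h : maharamInvariants Γ μ = maharamInvariants Γ' μ) :
    associatedFlow Γ μ = associatedFlow Γ' μ := by
  unfold associatedFlow
  congr!

end NonsingularDynamics

theorem proposition1p17
    {G : Type*} [Group G] [TopologicalSpace G] [IsTopologicalGroup G] [T2Space G]
    [LocallyCompactSpace G] [SecondCountableTopology G] [MeasurableSpace G] [BorelSpace G]
    {Z : ℕ → Type*} [∀ n, MeasurableSpace (Z n)] [∀ n, StandardBorelSpace (Z n)]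
    [∀ n, MulAction G (Z n)] [∀ n, MeasurableSMul₂ G (Z n)]
    (ν μ : ∀ n, Measure (Z n))
    [∀ n, IsProbabilityMeasure (ν n)] [∀ n, IsProbabilityMeasure (μ n)]
    (hS : IsIDPFT G ν μ)
    (g : ℕ → G) (hg : IsDispersed g)
    (ϑ : ℝ) (hϑ : ϑ ∈ Set.Ioo (1 : ℝ) 2)
    (hsum : ∀ᵐ z ∂(Measure.infinitePi μ),
      ∑' k, (rnCocycle (Measure.infinitePi μ) (g k)⁻¹ z) ^ ϑ = ∞)
    (hmix : ∀ n, IsMixingAlong (differenceSet g) (ν n)) :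
    maharamInvariants G (Measure.infinitePi μ)
        = maharamInvariants (directSum G) (Measure.infinitePi μ) ∧
      associatedFlow G (Measure.infinitePi μ)
        = associatedFlow (directSum G) (Measure.infinitePi μ) := by
  have hinvν : ∀ n, SMulInvariantMeasure G (Z n) (ν n) := fun n =>
    (hS.ergodic n).toSMulInvariantMeasure
  have hsmulG : MeasurableConstSMul G (∀ n, Z n) :=
    ⟨fun a => measurable_pi_iff.2 fun i => (measurable_pi_apply i).const_smul a⟩
  have h1 := fun n => (hS.equivalent n).1
  have h2 := fun n => (hS.equivalent n).2
  -- The diagonal action of `h` and the action of the constant sequence `h` are definitionally the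
  -- same transformation, so results pass freely between the two groups.
  have hns : ∀ h : G, NonsingularAt (Measure.infinitePi μ) (fun _ : ℕ => h) := hS.nonsingular
  have hrec : ∀ B : Set ((∀ i, Z i) × ℝ), MeasurableSet B →
      maharamMeasure (Measure.infinitePi μ) B ≠ 0 →
      ∃ᶠ h in cocompact G ⊓ 𝓟 (differenceSet g), maharamMeasure (Measure.infinitePi μ)
        (B ∩ maharamExtension (Measure.infinitePi μ) (fun _ : ℕ => h) ⁻¹' B) ≠ 0 := by
    intro B hB hB0
    -- A set of the filter contains the part of the difference set outside some compact `K`.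
    -- Dispersion supplies `N` beyond which all quotients avoid `K`, and recurrence is invoked past
    -- that `N`.
    refine frequently_iff.2 fun {U} hU => ?_
    obtain ⟨K, hK, hKU⟩ := mem_cocompact.1 (mem_inf_principal.1 hU)
    obtain ⟨N, hN⟩ := hg K hK
    obtain ⟨l, m, hm, hl, hlm⟩ :=
      exists_recurrence (Γ := G) hS.nonsingular g hϑ.1 hsum hB hB0 N
    exact ⟨g l * (g m)⁻¹, hKU (hN l m hm hl) ⟨l, m, hl, rfl⟩, hlm⟩
  have heq : maharamInvariants G (Measure.infinitePi μ)
      = maharamInvariants (directSum G) (Measure.infinitePi μ) := by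
    refine MeasurableSpace.ext fun A => ?_
    constructor
    · rintro ⟨hA, hinv⟩
      refine ⟨hA, fun a => ?_⟩
      have hfin : {n | (a : ℕ → G) n ≠ 1}.Finite := a.2
      exact (invariantAt_of_finite_support (fun n γ => invariantAt_mulSingle ν μ (h1 n) (h2 n)
        (hmix n) hA (fun h => ⟨hns h, hinv h⟩) hrec γ) hfin.toFinset a
        fun n hn => by simpa using hn).2
    · rintro ⟨hA, hinv⟩
      refine ⟨hA, fun h => ?_⟩
      exact (invariantAt_const ν μ h1 h2 (hns h) hA fun n =>
        ⟨nonsingularAt_mulSingle ν μ (h1 n) (h2 n) h,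
          hinv ⟨_, mulSingle_mem_directSum n h⟩⟩).2
  exact ⟨heq, associatedFlow_congr _ heq⟩
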